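/- **Trees.** Fix $d,m\in\mathbb N$. Let $\mathcal T$ be the set of (nonempty) rooted trees with vertex labels in $\{1,\dots,d\}$ and unordered branches, and $\mathcal F^0$ the set of unordered forests, including the empty forest $1$; $|\cdot|$ is the number of vertices, $[\tau_1\cdots\tau_n]_i$ is the tree obtained by attaching $\tau_1,\dots,\tau_n\in\mathcal T$ ($n\ge 0$) to a new root with label $i$, and $\mathcal T_p=\{\tau\in\mathcal T:|\tau|\le p\}$, $\mathcal F^0_p=\{\mathfrak h\in\mathcal F^0:|\mathfrak h|\le p\}$. The symmetry factor is defined recursively by $\sigma([\tau_1\cdots\tau_n]_i)=r_1!\cdots r_q!\prod_{j=1}^n\sigma(\tau_j)$, where $r_1,\dots,r_q$ are the multiplicities of the pairwise distinct trees among $\tau_1,\dots,\tau_n$. For vector fields $f=(f_1,\dots,f_d)$ on $\mathbb R^m$, the elementary differentials are $F([\tau_1\cdots\tau_n]_i)(y)=f_i^{(n)}(y)\bigl(F(\tau_1)(y),\dots,F(\tau_n)(y)\bigr)$ (so $F(\bullet_i)=f_i$). **Hopf algebra.** Let $\mathcal H$ be the real polynomial algebra in the variables $\mathcal T$ (with linear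 basis $\mathcal F^0$), with the multiplicative coproduct determined by $\Delta[\tau_1\cdots\tau_n]_a=[\tau_1\cdots\tau_n]_a\otimes 1+(\mathrm{id}\otimes B_+^a)(\Delta\tau_1\cdots\Delta\tau_n)$, where $B_+^a$ is linear with $B^a_+(\tau_1\cdots\tau_n)=[\tau_1\cdots\tau_n]_a$. For $\varphi,\psi\in\mathcal H^*$ put $\langle\varphi\star\psi,x\rangle=\langle\varphi\otimes\psi,\Delta x\rangle$. A forest $\mathfrak h$ is also regarded as the element of $\mathcal H^*$ that extracts the coefficient of $\mathfrak h$. **Rough paths.** Let $\alpha\in(0,1]$, $N=\lfloor 1/\alpha\rfloor$, $T\in\mathbb R$. An $\alpha$-branched rough path on $[0,T]$ is a map $\mathbf X:[0,T]^2\to\mathcal H^*$ such that every $\mathbf X_{s,t}$ is a character of the unital algebra $\mathcal H$, $\mathbf X_{s,t}=\mathbf X_{s,u}\star\mathbf X_{u,t}$ for all $s,u,t\in[0,T]$, and $\sup_{s\ne t}|\langle\mathbf X_{s,t},\tau\rangle|/|t-s|^{\alpha|\tau|}<\infty$ for every $\tau\in\mathcal T$. A path $\mathbf Z$ on $[t_0,T]$,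 given by coefficients $\langle\mathfrak h,\mathbf Z(t)\rangle\in\mathbb R^m$ for $\mathfrak h\in\mathcal F^0_{N-1}$, is controlled by $\mathbf X$ if for every $\mathfrak h\in\mathcal F^0_{N-1}$ there is $C$ with $$\Bigl|\langle\mathfrak h,\mathbf Z(t)\rangle-\sum_{\mathfrak g\in\mathcal F^0_{N-1}}\langle\mathbf X_{s,t}\star\mathfrak h,\mathfrak g\rangle\langle\mathfrak g,\mathbf Z(s)\rangle\Bigr|\le C|t-s|^{(N-|\mathfrak h|)\alpha}\qquad(s,t\in[t_0,T]).$$ Its rough integral $\int_s^t \mathbf Z\,d\mathbf X^i$ is the limit, as the mesh of the partition $\mathcal P$ of $[s,t]$ tends to $0$, of $\sum_{[u,v]\in\mathcal P}\sum_{\mathfrak h\in\mathcal F^0_{N-1}}\langle\mathfrak h,\mathbf Z(u)\rangle\langle\mathbf X_{u,v},[\mathfrak h]_i\rangle$. For $\phi:\mathbb R^m\to\mathbb R^m$ sufficiently smooth, $\phi(\mathbf Z)$ has the coefficients $\langle 1,\phi(\mathbf Z)\rangle=\phi(\langle 1,\mathbf Z\rangle)$ and, for $\mathfrak h\neq1$,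 $\langle\mathfrak h,\phi(\mathbf Z)\rangle=\sum_{n=1}^{N-1}\sum_{\mathfrak h_1\cdots\mathfrak h_n=\mathfrak h}\frac1{n!}\phi^{(n)}(\langle1,\mathbf Z\rangle)(\langle\mathfrak h_1,\mathbf Z\rangle,\dots,\langle\mathfrak h_n,\mathbf Z\rangle)$, the sum being over ordered tuples of nonempty forests. A path $y$ is a solution of $dy=f(y)\,d\mathbf X$, $y(t_0)=y_0$, on $[t_0,T]$ if $y(t_0)=y_0$ and there is a path $\mathbf Y$ on $[t_0,T]$ controlled by $\mathbf X$ with $\langle1,\mathbf Y(t)\rangle=y(t)$ such that $y(t)-y(s)=\sum_{i=1}^d\int_s^tf_i(\mathbf Y)\,d\mathbf X^i$ for all $t_0\le s\le t\le T$, and for all $t\in[t_0,T]$: $\langle[\mathfrak h]_i,\mathbf Y(t)\rangle=\langle\mathfrak h,f_i(\mathbf Y(t))\rangle$ for every tree $[\mathfrak h]_i\in\mathcal T_{N-1}$, and $\langle\mathfrak h,\mathbf Y(t)\rangle=0$ for every $\mathfrak h\in\mathcal F^0_{N-1}$ that is a product of at least two trees. **Theorem.** Let $\mathbf X$ be an $\alpha$-branched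 rough path on $[0,T]$, $\alpha\in(0,1]$, and let $p\ge\lfloor1/\alpha\rfloor$ be an integer. Let $f_1,\dots,f_d:\mathbb R^m\to\mathbb R^m$ be $p-1$ times continuously differentiable with locally Lipschitz $(p-1)$-th derivatives. Let $t_0\geq 0$ and let $y$ be a solution of $dy=f(y)\,d\mathbf X$, $y(t_0)=y_0$, on $[t_0,T]$. Then $$y(t_0+h)=y_0+\sum_{\tau\in\mathcal T_p}\frac1{\sigma(\tau)}\,F(\tau)(y_0)\,\langle\mathbf X_{t_0,t_0+h},\tau\rangle+\mathcal O\bigl(h^{(p+1)\alpha}\bigr),$$ that is, there is a constant $C$, independent of $h$, such that the norm of the error is at most $Ch^{(p+1)\alpha}$ for all $h>0$ with $t_0+h\le T$. -/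

import Mathlib

open scoped TensorProduct

namespace BSeries

/-! ## Rooted labelled trees -/

/-- Plane rooted trees with vertex labels in `{1, …, d}`: a root label and the list of branches. -/
inductive PlaneTree (d : ℕ) : Type
  | node : Fin d → List (PlaneTree d) → PlaneTree d

/-- One-step identification of plane trees: the branches at a vertex may be permuted, and an
identification may take place inside a branch. -/
inductive PlaneTree.Rel {d : ℕ} : PlaneTree d → PlaneTree d → Prop
  | perm (a : Fin d) {l l' : List (PlaneTree d)} (h : l.Perm l') : Rel (.node a l) (.node a l')
  | branch (a : Fin d) (l₁ l₂ : List (PlaneTree d)) {x y : PlaneTree d} (h : Rel x y) :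
      Rel (.node a (l₁ ++ x :: l₂)) (.node a (l₁ ++ y :: l₂))

/-- The set `𝒯` of nonempty rooted trees with vertex labels in `{1, …, d}`, in which the order of
the branches does not matter (`Quot` identifies along the equivalence relation generated). -/
def Tree (d : ℕ) : Type := Quot (PlaneTree.Rel (d := d))

/-- The set `ℱ⁰` of unordered forests; the empty forest `0` plays the role of the empty tree `1`,
and the (commutative) product of forests is the sum of multisets. -/
abbrev Forest (d : ℕ) : Type := Multiset (Tree d)

section trees

variable {d : ℕ}

/-- The tree represented by a plane tree. -/
def Tree.mk (x : PlaneTree d) : Tree d := Quot.mk _ x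

/-- A plane tree representing a given tree. -/
noncomputable def Tree.out (τ : Tree d) : PlaneTree d := Quot.out τ

theorem Tree.mk_out (τ : Tree d) : Tree.mk τ.out = τ := Quot.out_eq τ

theorem Tree.mk_eq {x y : PlaneTree d} (h : x.Rel y) : Tree.mk x = Tree.mk y := Quot.sound h

theorem Tree.ind {P : Tree d → Prop} (h : ∀ a l, P (Tree.mk (.node a l))) (τ : Tree d) : P τ :=
  Quot.ind (fun x => match x with | .node a l => h a l) τ

/-- Root label and multiset of branches of a plane tree. -/
def PlaneTree.unfold : PlaneTree d → Fin d × Forest d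
  | .node a l => (a, ((l.map Tree.mk : List (Tree d)) : Forest d))

theorem PlaneTree.unfold_congr {x y : PlaneTree d} (h : x.Rel y) : x.unfold = y.unfold := by
  cases h with
  | perm a h => exact Prod.ext rfl (Multiset.coe_eq_coe.2 (h.map _))
  | branch a l₁ l₂ h => simp [PlaneTree.unfold, Tree.mk_eq h]

/-- Root label and multiset of branches of a tree. -/
def Tree.unfold : Tree d → Fin d × Forest d :=
  Quot.lift PlaneTree.unfold fun _ _ h => PlaneTree.unfold_congr h

theorem Tree.unfold_mk (a : Fin d) (l : List (PlaneTree d)) :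
    (Tree.mk (.node a l)).unfold = (a, ((l.map Tree.mk : List (Tree d)) : Forest d)) := rfl

/-- The label of the root. -/
def Tree.root (τ : Tree d) : Fin d := τ.unfold.1

/-- The forest that remains when the root is removed. -/
def Tree.branches (τ : Tree d) : Forest d := τ.unfold.2

/-- The tree `[τ₁ ⋯ τₘ]_a`. -/
noncomputable def Tree.graft (a : Fin d) (h : Forest d) : Tree d :=
  Quot.lift (fun l : List (Tree d) => Tree.mk (.node a (l.map Tree.out)))
    (fun _ _ hl => Tree.mk_eq (.perm a (List.Perm.map _ hl))) h

theorem Tree.graft_coe (a : Fin d) (l : List (Tree d)) :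
    Tree.graft a (l : Forest d) = Tree.mk (.node a (l.map Tree.out)) := rfl

theorem Tree.unfold_graft (a : Fin d) (h : Forest d) : (Tree.graft a h).unfold = (a, h) := by
  induction h using Quotient.inductionOn with
  | _ l => simp [Tree.graft_coe, Tree.unfold_mk, Function.comp_def, Tree.mk_out]

@[simp] theorem Tree.root_graft (a : Fin d) (h : Forest d) : (Tree.graft a h).root = a := by
  simp [Tree.root, Tree.unfold_graft]

@[simp] theorem Tree.branches_graft (a : Fin d) (h : Forest d) :
    (Tree.graft a h).branches = h := by
  simp [Tree.branches, Tree.unfold_graft]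

theorem Tree.mk_node_congr (a : Fin d) (l₁ l₂ : List (PlaneTree d)) {x y : PlaneTree d}
    (h : Tree.mk x = Tree.mk y) :
    Tree.mk (.node a (l₁ ++ x :: l₂)) = Tree.mk (.node a (l₁ ++ y :: l₂)) := by
  have h' := Quot.eqvGen_exact h
  clear h
  induction h' with
  | rel x y h => exact Tree.mk_eq (.branch a l₁ l₂ h)
  | refl x => rfl
  | symm x y _ ih => exact ih.symm
  | trans x y z _ _ ih1 ih2 => exact ih1.trans ih2

/-- Every tree is `[τ₁ ⋯ τₘ]_a` for its root label `a` and its branches `τ₁, …, τₘ`. -/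
@[simp] theorem Tree.graft_root_branches (τ : Tree d) : Tree.graft τ.root τ.branches = τ := by
  induction τ using Tree.ind with
  | _ a l =>
    have key : ∀ l l₁ : List (PlaneTree d),
        Tree.mk (.node a (l₁ ++ (l.map Tree.mk).map Tree.out)) = Tree.mk (.node a (l₁ ++ l)) := by
      intro l
      induction l with
      | nil => intro l₁; rfl
      | cons x l ih =>
        intro l₁
        have h1 := Tree.mk_node_congr a l₁ ((l.map Tree.mk).map Tree.out)
          (x := (Tree.mk x).out) (y := x) (Tree.mk_out _)
        have h2 := ih (l₁ ++ [x])
        rw [List.append_assoc, List.append_assoc] at h2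
        exact h1.trans h2
    exact key l []

/-- Number of vertices of a plane tree. -/
def PlaneTree.size : PlaneTree d → ℕ
  | .node _ l => 1 + (l.map PlaneTree.size).sum

/-- The number `|τ|` of vertices of a tree. -/
def Tree.size : Tree d → ℕ :=
  Quot.lift PlaneTree.size (by
    intro x y h
    induction h with
    | perm a h => simp [PlaneTree.size, (h.map PlaneTree.size).sum_eq]
    | branch a l₁ l₂ h ih => simp [PlaneTree.size, ih])

/-- The number `|𝔥|` of vertices of a forest. -/
def Forest.size (h : Forest d) : ℕ := (h.map Tree.size).sum

theorem Tree.size_mk (x : PlaneTree d) : (Tree.mk x).size = x.size := rfl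

theorem Tree.size_eq (τ : Tree d) : τ.size = 1 + Forest.size τ.branches := by
  induction τ using Tree.ind with
  | _ a l =>
    simp [Tree.size_mk, Forest.size, Tree.branches, Tree.unfold_mk, PlaneTree.size,
      Function.comp_def]

theorem Tree.size_pos (τ : Tree d) : 0 < τ.size := by rw [Tree.size_eq]; omega

theorem Tree.size_le_forest {τ : Tree d} {h : Forest d} (hτ : τ ∈ h) : τ.size ≤ Forest.size h :=
  Multiset.le_sum_of_mem (Multiset.mem_map_of_mem _ hτ)

theorem Tree.size_lt {τ c : Tree d} (hc : c ∈ τ.branches) : c.size < τ.size := by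
  have := Tree.size_le_forest hc
  rw [Tree.size_eq τ]; omega

theorem Forest.card_le_size (h : Forest d) : Multiset.card h ≤ Forest.size h := by
  have := Multiset.card_nsmul_le_sum (s := h.map Tree.size) (a := 1) (by
    intro x hx
    obtain ⟨τ, -, rfl⟩ := Multiset.mem_map.1 hx
    exact τ.size_pos)
  simpa [Forest.size] using this

theorem finite_forest_of_finite_tree (n : ℕ) (hT : {τ : Tree d | τ.size ≤ n}.Finite) :
    {h : Forest d | Forest.size h ≤ n}.Finite := by
  have : Finite {τ : Tree d // τ.size ≤ n} := hT
  refine ((List.finite_length_le {τ : Tree d // τ.size ≤ n} n).image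
    (fun l => ((l.map Subtype.val : List (Tree d)) : Forest d))).subset ?_
  intro h hh
  induction h using Quot.inductionOn with
  | _ l =>
    have hl : ∀ τ ∈ l, τ.size ≤ n := fun τ hτ =>
      (Tree.size_le_forest (h := (l : Forest d)) (Multiset.mem_coe.2 hτ)).trans hh
    refine ⟨l.attachWith _ hl, ?_, congrArg _ (List.attachWith_map_subtype_val hl)⟩
    simpa using (Forest.card_le_size (l : Forest d)).trans hh

theorem finite_tree (n : ℕ) : {τ : Tree d | τ.size ≤ n}.Finite := by
  induction n with
  | zero =>
    convert Set.finite_empty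
    ext τ
    have := τ.size_pos
    simp; omega
  | succ n ih =>
    refine ((Set.finite_univ (α := Fin d)).prod (finite_forest_of_finite_tree n ih)).image
      (fun q => Tree.graft q.1 q.2) |>.subset ?_
    intro τ hτ
    refine ⟨(τ.root, τ.branches), ⟨Set.mem_univ _, ?_⟩, τ.graft_root_branches⟩
    have := τ.size_eq
    change τ.size ≤ n + 1 at hτ
    change Forest.size τ.branches ≤ n
    omega

end trees

/-- `𝒯ₙ`: the trees with at most `n` vertices. -/
noncomputable def treesUpTo (d n : ℕ) : Finset (Tree d) := (finite_tree (d := d) n).toFinset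

/-- `ℱ⁰ₙ`: the forests with at most `n` vertices, including the empty one. -/
noncomputable def forestsUpTo (d n : ℕ) : Finset (Forest d) :=
  (finite_forest_of_finite_tree (d := d) n (finite_tree n)).toFinset

open Classical in
/-- The symmetry factor `σ(τ) = r₁! ⋯ r_q! ∏ⱼ σ(τⱼ)`, where the multiplicities `r₁, …, r_q` are
those of the pairwise distinct trees among the branches `τⱼ` of `τ`. -/
noncomputable def Tree.symmFactor {d : ℕ} (τ : Tree d) : ℕ :=
  (∏ c ∈ τ.branches.toFinset, (τ.branches.count c).factorial) *
    (τ.branches.attach.map fun c => Tree.symmFactor c.1).prod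
termination_by τ.size
decreasing_by exact Tree.size_lt c.2

/-! ## The Connes–Kreimer Hopf algebra -/

/-- The algebra `ℋ` of polynomials in the trees. Its monomials are the forests. -/
abbrev CK (d : ℕ) : Type := MvPolynomial (Tree d) ℝ

section hopf

variable {d : ℕ}

/-- A forest as an element of `ℋ`: the product of its trees. -/
noncomputable def Forest.toCK (h : Forest d) : CK d := (h.map MvPolynomial.X).prod

/-- The linear operator `B₊ᵃ` on `ℋ`, given on forests by `τ₁ ⋯ τₙ ↦ [τ₁ ⋯ τₙ]_a`. -/
noncomputable def Bplus (a : Fin d) : CK d →ₗ[ℝ] CK d :=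
  (MvPolynomial.basisMonomials (Tree d) ℝ).constr ℝ
    fun s => MvPolynomial.X (Tree.graft a (Finsupp.toMultiset s))

/-- The coproduct on trees:
`Δ[τ₁ ⋯ τₘ]_a = [τ₁ ⋯ τₘ]_a ⊗ 1 + (id ⊗ B₊ᵃ)(Δτ₁ ⋯ Δτₘ)`. -/
noncomputable def coproductTree (τ : Tree d) : CK d ⊗[ℝ] CK d :=
  MvPolynomial.X τ ⊗ₜ[ℝ] 1 +
    (Bplus τ.root).lTensor (CK d) (τ.branches.attach.map fun c => coproductTree c.1).prod
termination_by τ.size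
decreasing_by exact Tree.size_lt c.2

/-- The coproduct `Δ : ℋ → ℋ ⊗ ℋ`, the multiplicative linear extension from trees. -/
noncomputable def coproduct (d : ℕ) : CK d →ₐ[ℝ] CK d ⊗[ℝ] CK d :=
  MvPolynomial.aeval coproductTree

/-- The product `φ ⋆ ψ` on the dual `ℋ*`: `⟨φ ⋆ ψ, x⟩ = ⟨φ ⊗ ψ, Δ x⟩`. -/
noncomputable def convolve (φ ψ : Module.Dual ℝ (CK d)) : Module.Dual ℝ (CK d) :=
  LinearMap.mul' ℝ ℝ ∘ₗ TensorProduct.map φ ψ ∘ₗ (coproduct d).toLinearMap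

open Classical in
/-- A forest as an element of the dual `ℋ*`: the coefficient of that forest, so that forests form
a dual pair of bases. -/
noncomputable def Forest.dual (h : Forest d) : Module.Dual ℝ (CK d) :=
  MvPolynomial.lcoeff ℝ (Multiset.toFinsupp h)

end hopf

/-! ## Branched rough paths, controlled paths and rough differential equations -/

/-- `X` is an `α`-branched rough path on `[0, T]`; only the values `X s t` with
`s, t ∈ [0, T]` matter. -/
structure IsBranchedRoughPath {d : ℕ} (α T : ℝ) (X : ℝ → ℝ → Module.Dual ℝ (CK d)) : Prop where
  /-- `X s t` is a character of `ℋ`. -/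
  map_one : ∀ s ∈ Set.Icc 0 T, ∀ t ∈ Set.Icc 0 T, X s t 1 = 1
  map_mul : ∀ s ∈ Set.Icc 0 T, ∀ t ∈ Set.Icc 0 T, ∀ x y : CK d,
    X s t x * X s t y = X s t (x * y)
  /-- Chen's relation. -/
  chen : ∀ s ∈ Set.Icc 0 T, ∀ u ∈ Set.Icc 0 T, ∀ t ∈ Set.Icc 0 T,
    X s t = convolve (X s u) (X u t)
  /-- Hölder regularity. -/
  holder : ∀ τ : Tree d, ∃ C : ℝ, ∀ s ∈ Set.Icc 0 T, ∀ t ∈ Set.Icc 0 T, s ≠ t →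
    |X s t (MvPolynomial.X τ)| ≤ C * |t - s| ^ (α * τ.size)

section controlled

variable {d m : ℕ}

/-- `N = ⌊1/α⌋`. -/
noncomputable def levels (α : ℝ) : ℕ := ⌊1 / α⌋₊

/-- A path `Z` with values in `(ℋ_{N-1})ᵐ`, given by its coefficients
`Z t 𝔥 = ⟨𝔥, Z(t)⟩ ∈ ℝᵐ` for the forests `𝔥` with at most `N - 1` vertices, is controlled by `X`
on `[a, b]`: `⟨𝔥, Z(t)⟩ = ⟨X_{s,t} ⋆ 𝔥, Z(s)⟩ + R^𝔥_{s,t}` with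
`|R^𝔥_{s,t}| ≤ C |t - s|^{(N - |𝔥|) α}`. -/
def IsControlled (α : ℝ) (X : ℝ → ℝ → Module.Dual ℝ (CK d)) (a b : ℝ)
    (Z : ℝ → Forest d → EuclideanSpace ℝ (Fin m)) : Prop :=
  ∀ h ∈ forestsUpTo d (levels α - 1), ∃ C : ℝ, ∀ s ∈ Set.Icc a b, ∀ t ∈ Set.Icc a b,
    ‖Z t h - ∑ g ∈ forestsUpTo d (levels α - 1), convolve (X s t) h.dual g.toCK • Z s g‖ ≤
      C * |t - s| ^ (((levels α : ℝ) - Forest.size h) * α)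

/-- The local approximation
`∑_{𝔥 ∈ ℱ⁰_{N-1}} ⟨𝔥, Z(u)⟩ ⟨X_{u,v}, [𝔥]_i⟩` of the integral of `Z` against `Xⁱ`. -/
noncomputable def localIntegral (α : ℝ) (X : ℝ → ℝ → Module.Dual ℝ (CK d))
    (Z : ℝ → Forest d → EuclideanSpace ℝ (Fin m)) (i : Fin d) (u v : ℝ) :
    EuclideanSpace ℝ (Fin m) :=
  ∑ h ∈ forestsUpTo d (levels α - 1), X u v (MvPolynomial.X (Tree.graft i h)) • Z u h

/-- `L` is the rough integral `∫_s^t Z(r) dXⁱ(r)`: the limit of the sums of local approximations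
over the partitions `s = u₀ < u₁ < ⋯ < uₙ = t` as the mesh size tends to `0`. -/
def IsRoughIntegral (α : ℝ) (X : ℝ → ℝ → Module.Dual ℝ (CK d))
    (Z : ℝ → Forest d → EuclideanSpace ℝ (Fin m)) (i : Fin d) (s t : ℝ)
    (L : EuclideanSpace ℝ (Fin m)) : Prop :=
  ∀ ε > 0, ∃ δ > 0, ∀ (n : ℕ) (u : ℕ → ℝ), u 0 = s → u n = t →
    (∀ k < n, u k < u (k + 1) ∧ u (k + 1) - u k < δ) →
    ‖∑ k ∈ Finset.range n, localIntegral α X Z i (u k) (u (k + 1)) - L‖ < ε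

open Classical in
/-- The coefficients of the composition `φ(Z)` of `Z ∈ (ℋ_{N-1})ᵐ` with a smooth map `φ`:
`⟨1, φ(Z)⟩ = φ(⟨1, Z⟩)` and, for `𝔥 ≠ 1`,
`⟨𝔥, φ(Z)⟩ = ∑_{n=1}^{N-1} ∑_{𝔥₁ ⋯ 𝔥ₙ = 𝔥} 1/n! φ⁽ⁿ⁾(⟨1, Z⟩)(⟨𝔥₁, Z⟩, …, ⟨𝔥ₙ, Z⟩)`, the inner
sum being over ordered tuples of nonempty forests. -/
noncomputable def compose (α : ℝ) (φ : EuclideanSpace ℝ (Fin m) → EuclideanSpace ℝ (Fin m))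
    (Z : Forest d → EuclideanSpace ℝ (Fin m)) (h : Forest d) : EuclideanSpace ℝ (Fin m) :=
  if h = 0 then φ (Z 0) else
    ∑ n ∈ Finset.Icc 1 (levels α - 1),
      ∑ g ∈ (Fintype.piFinset fun _ : Fin n =>
          (forestsUpTo d (levels α - 1)).erase 0).filter (fun g => ∑ j, g j = h),
        ((n.factorial : ℝ)⁻¹) • iteratedFDeriv ℝ n φ (Z 0) fun j => Z (g j)

/-- `J` is, on `[a, b]`, an integral `∫ Z(r) · dX(r)` of `Z = (Z¹, …, Z^d)` as a controlled path.
The coefficient of `1` has the increments `∑ᵢ ∫_s^t Zⁱ(r) dXⁱ(r)`; the coefficient of `[𝔥]_i`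
is that of `𝔥` in `Zⁱ`; those of products of two or more trees vanish. -/
structure IsControlledIntegral (α : ℝ) (X : ℝ → ℝ → Module.Dual ℝ (CK d)) (a b : ℝ)
    (Z : Fin d → ℝ → Forest d → EuclideanSpace ℝ (Fin m))
    (J : ℝ → Forest d → EuclideanSpace ℝ (Fin m)) : Prop where
  coeff_one : ∀ s ∈ Set.Icc a b, ∀ t ∈ Set.Icc a b, s ≤ t →
    ∃ L : Fin d → EuclideanSpace ℝ (Fin m),
      (∀ i, IsRoughIntegral α X (Z i) i s t (L i)) ∧ J t 0 - J s 0 = ∑ i, L i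
  coeff_tree : ∀ t ∈ Set.Icc a b, ∀ (i : Fin d) (h : Forest d),
    (Tree.graft i h).size ≤ levels α - 1 → J t {Tree.graft i h} = Z i t h
  coeff_forest : ∀ t ∈ Set.Icc a b, ∀ h ∈ forestsUpTo d (levels α - 1),
    2 ≤ Multiset.card h → J t h = 0

/-- `y` solves `dy(t) = f(y(t)) dX(t)`, `y(t₀) = y₀`, on `[t₀, T]`: there is a path `Y` above `y`
that is controlled by `X` and is an integral of `f(Y) = (f₁(Y), …, f_d(Y))` against `X`. -/
def IsRDESolution (α : ℝ) (X : ℝ → ℝ → Module.Dual ℝ (CK d))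
    (f : Fin d → EuclideanSpace ℝ (Fin m) → EuclideanSpace ℝ (Fin m)) (t₀ T : ℝ)
    (y₀ : EuclideanSpace ℝ (Fin m)) (y : ℝ → EuclideanSpace ℝ (Fin m)) : Prop :=
  y t₀ = y₀ ∧ ∃ Y : ℝ → Forest d → EuclideanSpace ℝ (Fin m),
    (∀ t ∈ Set.Icc t₀ T, Y t 0 = y t) ∧
    IsControlled α X t₀ T Y ∧
    IsControlledIntegral α X t₀ T (fun i t => compose α (f i) (Y t)) Y

/-- The elementary differential
`F([τ₁ ⋯ τₙ]_i)(y) = f_i⁽ⁿ⁾(y)(F(τ₁)(y), …, F(τₙ)(y))`. The branches are listed in some order,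
which is immaterial when `f_i` is `n` times continuously differentiable. -/
noncomputable def elemDiff
    (f : Fin d → EuclideanSpace ℝ (Fin m) → EuclideanSpace ℝ (Fin m)) (τ : Tree d)
    (y : EuclideanSpace ℝ (Fin m)) : EuclideanSpace ℝ (Fin m) :=
  iteratedFDeriv ℝ τ.branches.toList.length (f τ.root) y
    fun j => elemDiff f (τ.branches.toList.get j) y
termination_by τ.size
decreasing_by
  exact Tree.size_lt (Multiset.mem_toList.1 (List.get_mem _ _))

end controlled

end BSeries

/-! Write δ = (t - s)^α and N = ⌊1/α⌋, and lift y to the series whose coefficient at a tree τ is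
F(τ)(y)/σ(τ). The statement that propagates is stronger than the expansion: the lift truncated at Q
vertices is transported by X from s to t up to δ^(Q+1), uniformly in s < t (`IsTransported`). It is
tested against characters with values δ^|τ| μ(τ), for arbitrary fixed μ. For μ = 0 the test
character is the counit, and the case Q = p is the theorem. The proof is an induction on Q from N -
1 to p.

Characters make composition with f_i tractable. A lift tested against a character is a point of ℝ^m,
and f_i is Lipschitz on bounded sets, so the values of f_i at the two tested lifts agree up to
δ^(Q+1). Taylor's formula expands both values over forests: multiplicativity turns products of
values on trees into values on forests, and the recursions for F and σ say that the Taylor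
coefficient at 𝔥 is the coefficient of the lift at [𝔥]_i (`taylorCoeff_elemCoeff`). So f_i(Y) is
transported up to δ^(Q+1) against characters (`isBigO_defect_character`). Characters separate
forests (`exists_finsupp_character`), hence the defect of the single coefficient 𝔥 is O(δ^(Q+1-|𝔥|))
(`isBigO_defect_dual`).

By Chen's relation, the B-series increment Ξ with trees of at most Q + 1 vertices fails to be
additive at u exactly by these defects, tested against X_{u,t} ∘ B₊ (`bseriesIncrement_sub`). At
midpoints the failure is O(δ^(Q+2)), and (Q + 2)α > 1. The dyadic sums of Ξ converge to the
increments of y, because Ξ differs from the local rough integral only by trees with more than N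
vertices. Sewing then gives y(t) - y(s) = Ξ + O(δ^(Q+2)) (`isBigO_sub_bseriesIncrement`), and the
coproduct recursion upgrades this to transport at level Q + 1 (`IsTransported.succ_of_expansion`).
The base case is the definition of a controlled path (`IsControlled.isTransported`). The step from Q
needs Q derivatives of f with the last one locally Lipschitz, and Q ≤ p - 1. -/

namespace BSeries

open Asymptotics Filter Topology

section hopfLemmas

variable {d : ℕ}

/-! ## Forests as a basis of `ℋ` -/

@[simp] theorem Forest.toCK_zero : Forest.toCK (0 : Forest d) = 1 := by simp [Forest.toCK]

@[simp] theorem Forest.toCK_cons (τ : Tree d) (h : Forest d) :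
    Forest.toCK (τ ::ₘ h) = MvPolynomial.X τ * Forest.toCK h := by simp [Forest.toCK]

@[simp] theorem Forest.toCK_singleton (τ : Tree d) :
    Forest.toCK ({τ} : Forest d) = MvPolynomial.X τ := by simp [Forest.toCK]

@[simp] theorem Forest.size_zero : Forest.size (0 : Forest d) = 0 := by simp [Forest.size]

@[simp] theorem Forest.size_cons (τ : Tree d) (h : Forest d) :
    Forest.size (τ ::ₘ h) = τ.size + Forest.size h := by simp [Forest.size]

@[simp] theorem Forest.size_singleton (τ : Tree d) :
    Forest.size ({τ} : Forest d) = τ.size := by simp [Forest.size]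

theorem Tree.size_graft (a : Fin d) (h : Forest d) :
    (Tree.graft a h).size = 1 + Forest.size h := by
  rw [Tree.size_eq, Tree.branches_graft]

theorem mem_treesUpTo {n : ℕ} {τ : Tree d} : τ ∈ treesUpTo d n ↔ τ.size ≤ n := by
  simp [treesUpTo]

theorem mem_forestsUpTo {n : ℕ} {h : Forest d} : h ∈ forestsUpTo d n ↔ Forest.size h ≤ n := by
  simp [forestsUpTo]

open Classical in
theorem Forest.toCK_eq_monomial (h : Forest d) :
    h.toCK = MvPolynomial.monomial (Multiset.toFinsupp h) 1 := by
  induction h using Multiset.induction with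
  | empty => simp
  | cons τ h ih =>
    rw [Forest.toCK_cons, ih, ← Multiset.singleton_add, map_add, Multiset.toFinsupp_singleton,
      MvPolynomial.X, MvPolynomial.monomial_mul, one_mul]

theorem monomial_eq_toCK (s : Tree d →₀ ℕ) :
    (MvPolynomial.monomial s 1 : CK d) = Forest.toCK (Finsupp.toMultiset s) := by
  classical
  rw [Forest.toCK_eq_monomial, Finsupp.toMultiset_toFinsupp]

theorem CK.induction_on {P : CK d → Prop} (z : CK d) (toCK : ∀ h : Forest d, P h.toCK)
    (add : ∀ x y, P x → P y → P (x + y)) (smul : ∀ (c : ℝ) x, P x → P (c • x)) : P z := by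
  induction z using MvPolynomial.induction_on' with
  | monomial s c =>
    have := smul c _ (toCK (Finsupp.toMultiset s))
    rwa [← monomial_eq_toCK, MvPolynomial.smul_monomial, smul_eq_mul, mul_one] at this
  | add p q hp hq => exact add p q hp hq

theorem CK.dual_ext {φ ψ : Module.Dual ℝ (CK d)} (hφ : ∀ h : Forest d, φ h.toCK = ψ h.toCK) :
    φ = ψ := by
  ext1 s
  ext
  have := hφ (Finsupp.toMultiset s)
  rwa [← monomial_eq_toCK] at this

open Classical in
theorem Forest.dual_toCK (h g : Forest d) : h.dual g.toCK = if g = h then 1 else 0 := by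
  rw [Forest.dual, Forest.toCK_eq_monomial, MvPolynomial.lcoeff_apply, MvPolynomial.coeff_monomial]
  simp

theorem Bplus_toCK (a : Fin d) (h : Forest d) :
    Bplus a h.toCK = MvPolynomial.X (Tree.graft a h) := by
  classical
  have := (MvPolynomial.basisMonomials (Tree d) ℝ).constr_basis ℝ
    (fun s => (MvPolynomial.X (Tree.graft a (Finsupp.toMultiset s)) : CK d)) (Multiset.toFinsupp h)
  rw [MvPolynomial.coe_basisMonomials] at this
  rw [Forest.toCK_eq_monomial]
  simpa [Bplus] using this

/-! ## Dilations -/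

/-- The algebra endomorphism of `ℋ` that multiplies a tree `τ` by `r ^ |τ|`. -/
noncomputable def dilation (r : ℝ) : CK d →ₐ[ℝ] CK d :=
  MvPolynomial.aeval fun τ : Tree d => r ^ τ.size • (MvPolynomial.X τ : CK d)

theorem dilation_X (r : ℝ) (τ : Tree d) :
    dilation r (MvPolynomial.X τ) = r ^ τ.size • (MvPolynomial.X τ : CK d) := by
  simp [dilation]

theorem dilation_toCK (r : ℝ) (h : Forest d) :
    dilation r h.toCK = r ^ Forest.size h • h.toCK := by
  induction h using Multiset.induction with
  | empty => simp
  | cons τ h ih =>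
    rw [Forest.toCK_cons, map_mul, ih, dilation_X, Forest.size_cons, pow_add, smul_mul_smul_comm]

theorem dilation_Bplus (r : ℝ) (a : Fin d) (z : CK d) :
    dilation r (Bplus a z) = r • Bplus a (dilation r z) := by
  induction z using CK.induction_on with
  | toCK h =>
    rw [Bplus_toCK, dilation_X, dilation_toCK, map_smul, Bplus_toCK, smul_smul, Tree.size_graft,
      pow_add, pow_one]
  | add x y hx hy => simp only [map_add, hx, hy, smul_add]
  | smul c x hx => simp only [map_smul, hx, smul_comm c r]

/-! ## The coproduct and the convolution product -/

theorem coproduct_toCK (h : Forest d) :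
    coproduct d h.toCK = (h.map coproductTree).prod := by
  rw [Forest.toCK, map_multiset_prod, Multiset.map_map]
  congr 1
  exact Multiset.map_congr rfl fun τ _ => by simp [coproduct]

theorem coproduct_X (τ : Tree d) : coproduct d (MvPolynomial.X τ) = coproductTree τ := by
  simp [coproduct]

theorem coproductTree_graft (a : Fin d) (h : Forest d) :
    coproductTree (Tree.graft a h) = MvPolynomial.X (Tree.graft a h) ⊗ₜ[ℝ] 1 +
      (Bplus a).lTensor (CK d) (coproduct d h.toCK) := by
  rw [coproductTree, coproduct_toCK, Multiset.attach_map_val']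
  simp

theorem map_dilation_lTensor (r : ℝ) (a : Fin d) (w : CK d ⊗[ℝ] CK d) :
    Algebra.TensorProduct.map (dilation r) (dilation r) ((Bplus a).lTensor (CK d) w) =
      r • (Bplus a).lTensor (CK d) (Algebra.TensorProduct.map (dilation r) (dilation r) w) := by
  induction w using TensorProduct.induction_on with
  | zero => simp
  | tmul x y => simp [dilation_Bplus]
  | add x y hx hy => simp only [map_add, hx, hy, smul_add]

/-- The coproduct is graded: the vertices of a tree are distributed between the two legs. Dilating
both legs expresses this without a grading on the tensor product. -/
theorem map_dilation_coproductTree (r : ℝ) (n : ℕ) : ∀ τ : Tree d, τ.size = n →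
    Algebra.TensorProduct.map (dilation r) (dilation r) (coproductTree τ) =
      r ^ n • coproductTree τ := by
  induction n using Nat.strong_induction_on with
  | _ n ih =>
    intro τ hτ
    obtain ⟨a, h, rfl⟩ : ∃ a h, τ = Tree.graft a h := ⟨_, _, τ.graft_root_branches.symm⟩
    -- Only subforests of the branches are treated, since the induction hypothesis covers only trees
    -- smaller than τ.
    have key : ∀ g : Forest d, g ≤ h →
        Algebra.TensorProduct.map (dilation r) (dilation r) (coproduct d g.toCK) =
          r ^ Forest.size g • coproduct d g.toCK := by
      intro g
      induction g using Multiset.induction with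
      | empty => intro; simp
      | cons c g ihg =>
        intro hg
        have hc : c ∈ h := Multiset.mem_of_le hg (Multiset.mem_cons_self _ _)
        have hlt : c.size < n := by
          rw [← hτ]; exact Tree.size_lt (by rwa [Tree.branches_graft])
        rw [Forest.toCK_cons, map_mul, map_mul, ihg ((Multiset.le_cons_self _ _).trans hg),
          coproduct_X, ih _ hlt c rfl, Forest.size_cons, pow_add, smul_mul_smul_comm]
    rw [coproductTree_graft, map_add, map_dilation_lTensor, key h le_rfl, map_smul, smul_smul,
      ← hτ, Tree.size_graft, smul_add, pow_add, pow_one, Algebra.TensorProduct.map_tmul, dilation_X,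
      map_one, Tree.size_graft, pow_add, pow_one, TensorProduct.smul_tmul']

theorem coproduct_dilation (r : ℝ) (z : CK d) :
    coproduct d (dilation r z) =
      Algebra.TensorProduct.map (dilation r) (dilation r) (coproduct d z) := by
  have : (coproduct d).comp (dilation r) =
      (Algebra.TensorProduct.map (dilation r) (dilation r)).comp (coproduct d) := by
    refine MvPolynomial.algHom_ext fun τ => ?_
    simp only [AlgHom.comp_apply]
    rw [dilation_X, map_smul, coproduct_X, map_dilation_coproductTree r _ τ rfl]
  exact DFunLike.congr_fun this z

theorem convolve_apply (φ ψ : Module.Dual ℝ (CK d)) (z : CK d) :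
    convolve φ ψ z = LinearMap.mul' ℝ ℝ (TensorProduct.map φ ψ (coproduct d z)) := rfl

/-- The recursion for the coproduct, read on the dual. It is used with ψ = X_{u,t} for
near-additivity and with ψ a scaled character for passing from level Q to Q + 1. -/
theorem convolve_X_graft (φ ψ : Module.Dual ℝ (CK d)) (a : Fin d) (h : Forest d) :
    convolve φ ψ (MvPolynomial.X (Tree.graft a h)) =
      φ (MvPolynomial.X (Tree.graft a h)) * ψ 1 + convolve φ (ψ ∘ₗ Bplus a) h.toCK := by
  rw [convolve_apply, convolve_apply, coproduct_X, coproductTree_graft, map_add, map_add,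
    LinearMap.lTensor, ← LinearMap.comp_apply (TensorProduct.map φ ψ), ← TensorProduct.map_comp]
  simp

theorem convolve_comp_dilation (φ ψ : Module.Dual ℝ (CK d)) (r : ℝ) (z : CK d) :
    convolve (φ ∘ₗ (dilation r).toLinearMap) (ψ ∘ₗ (dilation r).toLinearMap) z =
      convolve φ ψ (dilation r z) := by
  rw [convolve_apply, convolve_apply, coproduct_dilation, TensorProduct.map_comp]
  rfl

/-- The character of `ℋ` with the given values on trees. -/
noncomputable def character (μ : Tree d → ℝ) : Module.Dual ℝ (CK d) :=
  (MvPolynomial.aeval μ : CK d →ₐ[ℝ] ℝ).toLinearMap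

@[simp] theorem character_X (μ : Tree d → ℝ) (τ : Tree d) :
    character μ (MvPolynomial.X τ) = μ τ := by simp [character]

@[simp] theorem character_one (μ : Tree d → ℝ) : character μ 1 = 1 := by simp [character]

theorem character_toCK (μ : Tree d → ℝ) (h : Forest d) :
    character μ h.toCK = (h.map μ).prod := by
  simp [character, Forest.toCK, map_multiset_prod]

theorem eq_character {φ : Module.Dual ℝ (CK d)} (h1 : φ 1 = 1) (h2 : ∀ x y, φ x * φ y = φ (x * y)) :
    φ = character fun τ => φ (MvPolynomial.X τ) := by
  have : AlgHom.ofLinearMap φ h1 (fun x y => (h2 x y).symm) =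
      MvPolynomial.aeval fun τ => φ (MvPolynomial.X τ) :=
    MvPolynomial.algHom_ext fun τ => by simp
  exact LinearMap.ext fun z => DFunLike.congr_fun this z

theorem character_comp_dilation (μ : Tree d → ℝ) (r : ℝ) :
    character μ ∘ₗ (dilation r).toLinearMap = character fun τ => r ^ τ.size * μ τ := by
  refine (eq_character (by simp) fun x y => ?_).trans ?_
  · simp [character]
  · congr 1
    ext τ
    simp [dilation_X]

/-- The coproduct is an algebra morphism, so the convolution of two characters is again
multiplicative. -/
theorem convolve_character (ξ μ : Tree d → ℝ) :
    convolve (character ξ) (character μ) =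
      character fun τ => convolve (character ξ) (character μ) (MvPolynomial.X τ) := by
  let Θ : CK d →ₐ[ℝ] ℝ := (Algebra.TensorProduct.lmul' ℝ).comp
    ((Algebra.TensorProduct.map (MvPolynomial.aeval ξ) (MvPolynomial.aeval μ)).comp (coproduct d))
  have hΘ : ∀ z, convolve (character ξ) (character μ) z = Θ z := fun z => rfl
  refine eq_character (by rw [hΘ, map_one]) fun x y => ?_
  rw [hΘ, hΘ, hΘ, map_mul]

/-- The left legs of the coproduct of `z`, indexed by the forests in the right legs. -/
theorem exists_convolve_eq_sum (z : CK d) : ∃ A : Forest d →₀ CK d,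
    ∀ φ ψ : Module.Dual ℝ (CK d), convolve φ ψ z = A.sum fun h a => φ a * ψ h.toCK := by
  suffices H : ∀ w : CK d ⊗[ℝ] CK d, ∃ A : Forest d →₀ CK d, ∀ φ ψ : Module.Dual ℝ (CK d),
      LinearMap.mul' ℝ ℝ (TensorProduct.map φ ψ w) = A.sum fun h a => φ a * ψ h.toCK from
    H (coproduct d z)
  have hadd : ∀ x y : CK d ⊗[ℝ] CK d, (∃ A : Forest d →₀ CK d, ∀ φ ψ : Module.Dual ℝ (CK d),
      LinearMap.mul' ℝ ℝ (TensorProduct.map φ ψ x) = A.sum fun h a => φ a * ψ h.toCK) →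
      (∃ A : Forest d →₀ CK d, ∀ φ ψ : Module.Dual ℝ (CK d),
      LinearMap.mul' ℝ ℝ (TensorProduct.map φ ψ y) = A.sum fun h a => φ a * ψ h.toCK) →
      ∃ A : Forest d →₀ CK d, ∀ φ ψ : Module.Dual ℝ (CK d),
      LinearMap.mul' ℝ ℝ (TensorProduct.map φ ψ (x + y)) = A.sum fun h a => φ a * ψ h.toCK := by
    classical
    rintro x y ⟨A, hA⟩ ⟨B, hB⟩
    refine ⟨A + B, fun φ ψ => ?_⟩
    rw [map_add, map_add, hA, hB, Finsupp.sum_add_index] <;> simp [add_mul]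
  intro w
  induction w using TensorProduct.induction_on with
  | zero => exact ⟨0, by simp⟩
  | add x y hx hy => exact hadd x y hx hy
  | tmul a b =>
    induction b using CK.induction_on with
    | toCK h => exact ⟨Finsupp.single h a, fun φ ψ => by simp [Finsupp.sum_single_index]⟩
    | add x y hx hy => rw [TensorProduct.tmul_add]; exact hadd _ _ hx hy
    | smul c x hx =>
      obtain ⟨A, hA⟩ := hx
      refine ⟨A.mapRange (c • ·) (by simp), fun φ ψ => ?_⟩
      rw [TensorProduct.tmul_smul, map_smul, map_smul, hA, Finsupp.sum_mapRange_index (by simp),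
        Finsupp.smul_sum]
      simp [mul_assoc]

theorem continuous_dilation (φ : Module.Dual ℝ (CK d)) (z : CK d) :
    Continuous fun r => φ (dilation r z) := by
  induction z using CK.induction_on with
  | toCK h => simp only [dilation_toCK, map_smul, smul_eq_mul]; fun_prop
  | add x y hx hy => simp only [map_add]; exact hx.add hy
  | smul c x hx => simp only [map_smul]; exact hx.const_smul c

theorem dual_comp_dilation (h : Forest d) (r : ℝ) :
    h.dual ∘ₗ (dilation r).toLinearMap = r ^ Forest.size h • h.dual := by
  classical
  refine CK.dual_ext fun g => ?_
  simp only [LinearMap.comp_apply, LinearMap.smul_apply, AlgHom.toLinearMap_apply,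
    dilation_toCK, map_smul, Forest.dual_toCK]
  split_ifs with hs <;> simp [hs]

/-- No right leg of the coproduct has more vertices than the forest itself. Homogeneity under
dilation forces a positive power of r to cancel for every r ≠ 0, and letting r tend to 0 kills the
term. -/
theorem convolve_dual_eq_zero (φ : Module.Dual ℝ (CK d)) {h g : Forest d}
    (hg : Forest.size g < Forest.size h) : convolve φ h.dual g.toCK = 0 := by
  classical
  obtain ⟨A, hA⟩ := exists_convolve_eq_sum g.toCK
  have hA' : ∀ φ : Module.Dual ℝ (CK d), convolve φ h.dual g.toCK = φ (A h) := by
    intro φ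
    rw [hA, Finsupp.sum, Finset.sum_eq_single h]
    · simp [Forest.dual_toCK]
    · intro b _ hb; simp [Forest.dual_toCK, hb]
    · intro hh; simp [Finsupp.notMem_support_iff.1 hh]
  obtain ⟨k, hk⟩ := Nat.exists_eq_add_of_lt hg
  have key : ∀ r : ℝ, r ≠ 0 → r ^ (k + 1) * φ (dilation r (A h)) = φ (A h) := by
    intro r hr
    have h1 := convolve_comp_dilation φ h.dual r g.toCK
    obtain ⟨B, hB⟩ := exists_convolve_eq_sum g.toCK
    have hsm : convolve (φ ∘ₗ (dilation r).toLinearMap) (r ^ Forest.size h • h.dual) g.toCK =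
        r ^ Forest.size h *
          convolve (φ ∘ₗ (dilation r).toLinearMap) h.dual g.toCK := by
      rw [hA, hA, Finsupp.sum, Finsupp.sum, Finset.mul_sum]
      refine Finset.sum_congr rfl fun x _ => ?_
      simp only [LinearMap.smul_apply, smul_eq_mul]; ring
    rw [dual_comp_dilation, hsm, dilation_toCK, map_smul, hA', hA', hk] at h1
    simp only [LinearMap.comp_apply, AlgHom.toLinearMap_apply, smul_eq_mul] at h1
    have hr' : r ^ Forest.size g ≠ 0 := pow_ne_zero _ hr
    apply mul_left_cancel₀ hr'
    rw [← h1]; ring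
  have hc : Continuous fun r : ℝ => r ^ (k + 1) * φ (dilation r (A h)) :=
    (continuous_pow _).mul (continuous_dilation φ _)
  have := hc.ext_on (dense_compl_singleton (0 : ℝ)) continuous_const (fun r hr => key r hr)
  have h0 := congrFun this 0
  rw [hA', ← h0]; simp

/-- Expansion of a convolution along the dual basis of the forests. -/
theorem convolve_eq_sum (φ ψ : Module.Dual ℝ (CK d)) {n : ℕ} {g : Forest d}
    (hg : Forest.size g ≤ n) :
    convolve φ ψ g.toCK =
      ∑ h ∈ forestsUpTo d n, ψ h.toCK * convolve φ h.dual g.toCK := by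
  classical
  obtain ⟨A, hA⟩ := exists_convolve_eq_sum g.toCK
  have hA' : ∀ h : Forest d, convolve φ h.dual g.toCK = φ (A h) := by
    intro h
    rw [hA, Finsupp.sum, Finset.sum_eq_single h]
    · simp [Forest.dual_toCK]
    · intro b _ hb; simp [Forest.dual_toCK, hb]
    · intro hh; simp [Finsupp.notMem_support_iff.1 hh]
  have h1 : convolve φ ψ g.toCK =
      ∑ h ∈ A.support ∪ forestsUpTo d n, ψ h.toCK * φ (A h) := by
    rw [hA, Finsupp.sum]
    refine (Finset.sum_congr rfl fun h _ => mul_comm _ _).trans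
      (Finset.sum_subset Finset.subset_union_left fun h _ hh => ?_)
    simp [Finsupp.notMem_support_iff.1 hh]
  rw [h1]
  refine (Finset.sum_subset Finset.subset_union_right fun h _ hh => ?_).symm.trans
    (Finset.sum_congr rfl fun h _ => by rw [hA'])
  rw [mem_forestsUpTo] at hh
  rw [← hA', convolve_dual_eq_zero φ (by omega), mul_zero]

theorem convolve_zero_right (φ : Module.Dual ℝ (CK d)) : convolve φ 0 = 0 := by
  ext1 s
  ext
  simp [convolve]

/-- The character vanishing on all trees is the counit, hence neutral for ⋆. This recovers the plain
B-series from `IsTransported`. -/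
theorem convolve_character_zero_X (φ : Module.Dual ℝ (CK d)) (τ : Tree d) :
    convolve φ (character fun _ => 0) (MvPolynomial.X τ) = φ (MvPolynomial.X τ) := by
  rw [← τ.graft_root_branches, convolve_X_graft]
  have : (character fun _ : Tree d => (0 : ℝ)) ∘ₗ Bplus τ.root = 0 := by
    refine CK.dual_ext fun g => ?_
    simp [Bplus_toCK]
  rw [this, convolve_zero_right]
  simp

/-! ## Boundedness of families of functionals -/

theorem isBigO_character {ι : Type*} {l : Filter ι} {ξ : ι → Tree d → ℝ}
    (hξ : ∀ τ, (fun ω => ξ ω τ) =O[l] fun _ => (1 : ℝ)) (z : CK d) :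
    (fun ω => character (ξ ω) z) =O[l] fun _ => (1 : ℝ) := by
  induction z using CK.induction_on with
  | toCK h =>
    induction h using Multiset.induction with
    | empty => simpa using isBigO_refl (fun _ : ι => (1 : ℝ)) l
    | cons τ h ih =>
      simp only [character_toCK, Multiset.map_cons, Multiset.prod_cons] at ih ⊢
      simpa using (hξ τ).mul ih
  | add x y hx hy => simpa only [map_add] using hx.add hy
  | smul c x hx => simpa only [map_smul, smul_eq_mul] using hx.const_mul_left c

theorem isBigO_convolve {ι : Type*} {l : Filter ι} {φ ψ : ι → Module.Dual ℝ (CK d)}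
    (hφ : ∀ z, (fun ω => φ ω z) =O[l] fun _ => (1 : ℝ))
    (hψ : ∀ z, (fun ω => ψ ω z) =O[l] fun _ => (1 : ℝ)) (z : CK d) :
    (fun ω => convolve (φ ω) (ψ ω) z) =O[l] fun _ => (1 : ℝ) := by
  obtain ⟨A, hA⟩ := exists_convolve_eq_sum z
  simp only [hA, Finsupp.sum]
  exact IsBigO.fun_sum fun h _ => by simpa only [mul_one] using (hφ (A h)).mul (hψ h.toCK)

/-! ## Characters separate the forests -/

open Classical in
/-- On a finite set of forests, the coefficient functionals are combinations of characters. -/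
theorem exists_finsupp_character (H : Finset (Forest d)) (h : Forest d) :
    ∃ c : (Tree d → ℝ) →₀ ℝ, ∀ g ∈ H,
      (c.sum fun μ a => a * character μ g.toCK) = if g = h then 1 else 0 := by
  let e : (Tree d → ℝ) → (H → ℝ) := fun μ g => character μ g.1.toCK
  have htop : Submodule.span ℝ (Set.range e) = ⊤ := by
    -- A functional vanishing on all evaluation vectors gives a polynomial that vanishes at every
    -- real point. It is therefore zero, and its coefficients are the values of the functional on
    -- the standard basis.
    by_contra hne
    obtain ⟨φ, hφ, hle⟩ := Submodule.exists_le_ker_of_lt_top _ (lt_top_iff_ne_top.2 hne)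
    apply hφ
    let P : CK d := ∑ g : H, φ (Pi.single g 1) • g.1.toCK
    have hP : P = 0 := by
      refine MvPolynomial.funext fun μ => ?_
      have h0 : φ (e μ) = 0 := hle (Submodule.subset_span ⟨μ, rfl⟩)
      rw [map_zero, ← h0, ← Finset.univ_sum_single (e μ), map_sum, map_sum]
      refine Finset.sum_congr rfl fun g _ => ?_
      have : Pi.single g (e μ g) = e μ g • (Pi.single g 1 : H → ℝ) := by
        rw [← Pi.single_smul, smul_eq_mul, mul_one]
      rw [this, MvPolynomial.smul_eval, φ.map_smul, smul_eq_mul, mul_comm]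
      rfl
    refine (Pi.basisFun ℝ H).ext fun g => ?_
    have h1 : g.1.dual P = 0 := by rw [hP, map_zero]
    have h2 : g.1.dual P = φ (Pi.single g 1) := by
      simp only [P, map_sum, map_smul, Forest.dual_toCK, smul_eq_mul]
      rw [Finset.sum_eq_single g]
      · simp
      · intro b _ hb
        rw [if_neg (fun h => hb (Subtype.ext h)), mul_zero]
      · simp
    rw [Pi.basisFun_apply, ← h2, h1, LinearMap.zero_apply]
  have hmem : (fun g : H => if g.1 = h then (1 : ℝ) else 0) ∈ Submodule.span ℝ (Set.range e) := by
    rw [htop]; trivial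
  obtain ⟨c, hc⟩ := Finsupp.mem_span_range_iff_exists_finsupp.1 hmem
  refine ⟨c, fun g hg => ?_⟩
  have := congrFun hc ⟨g, hg⟩
  rw [← this, Finsupp.sum, Finsupp.sum, Finset.sum_apply]
  rfl

end hopfLemmas

/-! ## Taylor expansion with a Lipschitz highest derivative -/

/-- Here `c n` plays the n-th derivative of `c 0`. The derivative of the remainder is the remainder
of the shifted sequence, and the mean value inequality on [0, 1] preserves the bound K. The
factorial gain is not needed. -/
theorem norm_sub_taylor_sum_le {F : Type*} [NormedAddCommGroup F] [NormedSpace ℝ F] {K : ℝ}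
    (k : ℕ) (c : ℕ → ℝ → F)
    (hd : ∀ n < k, ∀ s ∈ Set.Icc (0 : ℝ) 1, HasDerivAt (c n) (c (n + 1) s) s)
    (hK : ∀ s ∈ Set.Icc (0 : ℝ) 1, ‖c k s - c k 0‖ ≤ K) :
    ∀ s ∈ Set.Icc (0 : ℝ) 1,
      ‖c 0 s - ∑ n ∈ Finset.range (k + 1), (s ^ n / n.factorial) • c n 0‖ ≤ K := by
  induction k generalizing c with
  | zero => intro s hs; simpa using hK s hs
  | succ k ih =>
    have ih' := ih (fun n => c (n + 1)) (fun n hn s hs => hd (n + 1) (by omega) s hs) hK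
    have hpow : ∀ (n : ℕ) (s : ℝ),
        HasDerivAt (fun s : ℝ => s ^ (n + 1) / (n + 1).factorial) (s ^ n / n.factorial) s := by
      intro n s
      refine ((hasDerivAt_pow (n + 1) s).div_const ((n + 1).factorial : ℝ)).congr_deriv ?_
      rw [Nat.factorial_succ]
      have : (n.factorial : ℝ) ≠ 0 := by exact_mod_cast n.factorial_ne_zero
      push_cast
      field_simp
    have hder : ∀ s ∈ Set.Icc (0 : ℝ) 1,
        HasDerivAt (fun s => c 0 s - ∑ n ∈ Finset.range (k + 2), (s ^ n / n.factorial) • c n 0)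
          (c 1 s - ∑ n ∈ Finset.range (k + 1), (s ^ n / n.factorial) • c (n + 1) 0) s := by
      intro s hs
      refine (hd 0 (by omega) s hs).sub ?_
      simp only [Finset.sum_range_succ' _ (k + 1)]
      simpa using (HasDerivAt.fun_sum fun n _ => (hpow n s).smul_const (c (n + 1) 0)).add_const
        (c 0 0)
    intro s hs
    have hK0 : 0 ≤ K := (norm_nonneg _).trans (hK s hs)
    have h0 : (c 0 0 - ∑ n ∈ Finset.range (k + 2), ((0 : ℝ) ^ n / n.factorial) • c n 0) = 0 := by
      rw [Finset.sum_range_succ']; simp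
    have := norm_image_sub_le_of_norm_deriv_le_segment'
      (fun x hx => (hder x hx).hasDerivWithinAt) (fun x hx => ih' x (Set.Ico_subset_Icc_self hx)) s hs
    rw [h0, sub_zero, sub_zero] at this
    exact this.trans (mul_le_of_le_one_right hK0 hs.2)

section taylor

variable {E F : Type*} [NormedAddCommGroup E] [NormedSpace ℝ E] [NormedAddCommGroup F]
  [NormedSpace ℝ F]

theorem hasDerivAt_iteratedFDeriv_line {f : E → F} {k n : ℕ} (hf : ContDiff ℝ (k : ℕ∞) f)
    (hn : n < k) (x v : E) (s : ℝ) :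
    HasDerivAt (fun s : ℝ => iteratedFDeriv ℝ n f (x + s • v) fun _ => v)
      (iteratedFDeriv ℝ (n + 1) f (x + s • v) fun _ => v) s := by
  have h1 : HasFDerivAt (iteratedFDeriv ℝ n f) (fderiv ℝ (iteratedFDeriv ℝ n f) (x + s • v))
      (x + s • v) :=
    ((hf.differentiable_iteratedFDeriv (by exact_mod_cast hn)) _).hasFDerivAt
  have h2 : HasDerivAt (fun s : ℝ => x + s • v) v s := by
    simpa using ((hasDerivAt_id s).smul_const v).const_add x
  have h3 := h1.comp_hasDerivAt s h2
  have h4 := (ContinuousMultilinearMap.apply ℝ (fun _ : Fin n => E) F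
    (fun _ => v)).hasFDerivAt.comp_hasDerivAt s h3
  rw [iteratedFDeriv_succ_apply_left]
  exact h4

/-- Restriction to the segment from x to x + v: the k slots contribute ‖v‖^k, and the Lipschitz
variation of the k-th derivative contributes one more factor. -/
theorem norm_sub_taylor_le {f : E → F} {k : ℕ} (hf : ContDiff ℝ (k : ℕ∞) f) {S : Set E}
    (hS : Convex ℝ S) {K : NNReal} (hK : LipschitzOnWith K (iteratedFDeriv ℝ k f) S) {x v : E}
    (hx : x ∈ S) (hv : x + v ∈ S) :
    ‖f (x + v) - ∑ n ∈ Finset.range (k + 1),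
      (n.factorial : ℝ)⁻¹ • iteratedFDeriv ℝ n f x fun _ => v‖ ≤ K * ‖v‖ ^ (k + 1) := by
  have hmem : ∀ s ∈ Set.Icc (0 : ℝ) 1, x + s • v ∈ S := fun s hs => hS.add_smul_mem hx hv hs
  have := norm_sub_taylor_sum_le (K := K * ‖v‖ ^ (k + 1)) k
    (fun n s => iteratedFDeriv ℝ n f (x + s • v) fun _ => v)
    (fun n hn s _ => hasDerivAt_iteratedFDeriv_line hf hn x v s) (fun s hs => by
      rw [← sub_apply]
      refine (ContinuousMultilinearMap.le_opNorm _ _).trans ?_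
      have h1 := hK.norm_sub_le (hmem s hs) (hmem 0 (by simp))
      have h2 : ‖x + s • v - (x + (0 : ℝ) • v)‖ ≤ ‖v‖ := by
        rw [zero_smul, add_zero, add_sub_cancel_left, norm_smul, Real.norm_eq_abs,
          abs_of_nonneg hs.1]
        exact mul_le_of_le_one_left (norm_nonneg _) hs.2
      rw [Finset.prod_const, Finset.card_univ, Fintype.card_fin, pow_succ', ← mul_assoc]
      gcongr
      exact h1.trans (by gcongr)) 1 (by simp)
  simpa using this

theorem locallyLipschitz_iteratedFDeriv {f : E → F} {P k : ℕ} (hf : ContDiff ℝ (P : ℕ∞) f)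
    (hf' : LocallyLipschitz (iteratedFDeriv ℝ P f)) (hk : k ≤ P) :
    LocallyLipschitz (iteratedFDeriv ℝ k f) := by
  rcases hk.eq_or_lt with rfl | hlt
  · exact hf'
  · refine ContDiff.locallyLipschitz (𝕂 := ℝ) (hf.iteratedFDeriv_right (m := 1) ?_)
    exact_mod_cast (by omega : 1 + k ≤ P)

theorem exists_lipschitzOnWith_iteratedFDeriv [ProperSpace E] {f : E → F} {k : ℕ}
    (hf : LocallyLipschitz (iteratedFDeriv ℝ k f)) (R : ℝ) :
    ∃ K, LipschitzOnWith K (iteratedFDeriv ℝ k f) (Metric.closedBall 0 R) :=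
  LocallyLipschitzOn.exists_lipschitzOnWith_of_compact (isCompact_closedBall 0 R)
    hf.locallyLipschitzOn

theorem norm_sub_le_of_lipschitzOnWith_iteratedFDeriv_zero {f : E → F} {S : Set E} {K : NNReal}
    (hK : LipschitzOnWith K (iteratedFDeriv ℝ 0 f) S) {x y : E} (hx : x ∈ S) (hy : y ∈ S) :
    ‖f x - f y‖ ≤ K * ‖x - y‖ := by
  have h := hK.norm_sub_le hx hy
  have h2 := (iteratedFDeriv ℝ 0 f x - iteratedFDeriv ℝ 0 f y).le_opNorm 0
  simp only [sub_apply, iteratedFDeriv_zero_apply, Finset.univ_eq_empty,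
    Finset.prod_empty, mul_one] at h2
  exact h2.trans h

variable {ι : Type*} {l : Filter ι}

theorem exists_eventually_mem_closedBall {E : Type*} [NormedAddCommGroup E] {a : ι → E}
    (ha : a =O[l] fun _ => (1 : ℝ)) :
    ∃ R, ∀ R' ≥ R, ∀ᶠ ω in l, a ω ∈ Metric.closedBall (0 : E) R' := by
  obtain ⟨R, hR⟩ := ha.bound
  refine ⟨R, fun R' h => hR.mono fun ω hω => ?_⟩
  rw [mem_closedBall_zero_iff]
  simpa using hω.trans (by simpa using h)

theorem isBigO_comp_of_continuous {E F : Type*} [NormedAddCommGroup E] [NormedAddCommGroup F]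
    [ProperSpace E] {g : E → F} (hg : Continuous g) {a : ι → E}
    (ha : a =O[l] fun _ => (1 : ℝ)) : (fun ω => g (a ω)) =O[l] fun _ => (1 : ℝ) := by
  obtain ⟨R, hR⟩ := exists_eventually_mem_closedBall ha
  obtain ⟨C, hC⟩ := (isCompact_closedBall (0 : E) R).exists_bound_of_continuousOn hg.continuousOn
  refine IsBigO.of_bound C ((hR R le_rfl).mono fun ω hω => ?_)
  simpa using hC _ hω

theorem isBigO_pow_of_le {δ : ι → ℝ} (hδ : δ =O[l] fun _ => (1 : ℝ)) {i j : ℕ} (hij : i ≤ j) :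
    (fun ω => δ ω ^ j) =O[l] fun ω => δ ω ^ i := by
  obtain ⟨k, rfl⟩ := Nat.exists_eq_add_of_le hij
  simpa [pow_add] using (isBigO_refl (fun ω => δ ω ^ i) l).mul (hδ.pow k)

end taylor

/-! ## Expansion of a smooth function along a combination of trees -/

section expansion

variable {d : ℕ} {E : Type*} [NormedAddCommGroup E] [NormedSpace ℝ E] [ProperSpace E]
variable {ι : Type*} {l : Filter ι}

open Classical in
/-- The coefficient of the forest `h` in the Taylor expansion at `a` of `φ (a + ∑ τ, W τ • τ)`. -/
noncomputable def taylorCoeff (Q : ℕ) (φ : E → E) (a : E) (W : Tree d → E) (h : Forest d) : E :=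
  ∑ n ∈ Finset.range (Q + 1),
    ∑ g ∈ (Fintype.piFinset fun _ : Fin n => treesUpTo d Q) with Finset.univ.val.map g = h,
      (n.factorial : ℝ)⁻¹ • iteratedFDeriv ℝ n φ a fun j => W (g j)

theorem isBigO_forest_prod {δ : ι → ℝ} {μ : ι → Tree d → ℝ}
    (hμ : ∀ τ, (fun ω => μ ω τ) =O[l] fun ω => δ ω ^ τ.size) (h : Forest d) :
    (fun ω => (h.map (μ ω)).prod) =O[l] fun ω => δ ω ^ Forest.size h := by
  induction h using Multiset.induction with
  | empty => simpa using isBigO_refl (fun _ : ι => (1 : ℝ)) l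
  | cons τ h ih => simpa [pow_add] using (hμ τ).mul ih

theorem isBigO_sum_trees {E : Type*} [NormedAddCommGroup E] [NormedSpace ℝ E] {Q : ℕ}
    {δ : ι → ℝ} (hδ : δ =O[l] fun _ => (1 : ℝ)) {μ : ι → Tree d → ℝ}
    (hμ : ∀ τ, (fun ω => μ ω τ) =O[l] fun ω => δ ω ^ τ.size) {W : ι → Tree d → E}
    (hW : ∀ τ ∈ treesUpTo d Q, (fun ω => W ω τ) =O[l] fun _ => (1 : ℝ)) :
    (fun ω => ∑ τ ∈ treesUpTo d Q, μ ω τ • W ω τ) =O[l] δ := by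
  refine IsBigO.fun_sum fun τ hτ => ?_
  have h1 := (hμ τ).trans (isBigO_pow_of_le hδ (Nat.succ_le_of_lt τ.size_pos))
  simpa using h1.smul (hW τ hτ)

/-- The displacement is O(δ), so the Taylor remainder of order Q is O(δ^(Q+1)). Expanding the
multilinear terms gives tuples of trees weighted by δ to their number of vertices, so those with
more than Q vertices may be dropped. -/
theorem isBigO_sub_sum_taylorCoeff {Q : ℕ} {φ : E → E} (hφ : ContDiff ℝ (Q : ℕ∞) φ)
    (hφ' : LocallyLipschitz (iteratedFDeriv ℝ Q φ))
    {δ : ι → ℝ} (hδ : δ =O[l] fun _ => (1 : ℝ)) {a : ι → E} (ha : a =O[l] fun _ => (1 : ℝ))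
    {μ : ι → Tree d → ℝ} (hμ : ∀ τ, (fun ω => μ ω τ) =O[l] fun ω => δ ω ^ τ.size)
    {W : ι → Tree d → E} (hW : ∀ τ ∈ treesUpTo d Q, (fun ω => W ω τ) =O[l] fun _ => (1 : ℝ)) :
    (fun ω => φ (a ω + ∑ τ ∈ treesUpTo d Q, μ ω τ • W ω τ) -
      ∑ h ∈ forestsUpTo d Q, (h.map (μ ω)).prod • taylorCoeff Q φ (a ω) (W ω) h)
      =O[l] fun ω => δ ω ^ (Q + 1) := by
  classical
  set v : ι → E := fun ω => ∑ τ ∈ treesUpTo d Q, μ ω τ • W ω τ with hv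
  have hvδ : v =O[l] δ := isBigO_sum_trees hδ hμ hW
  obtain ⟨R₁, hR₁⟩ := exists_eventually_mem_closedBall ha
  obtain ⟨R₂, hR₂⟩ := exists_eventually_mem_closedBall (ha.add (hvδ.trans hδ))
  obtain ⟨K, hK⟩ := exists_lipschitzOnWith_iteratedFDeriv hφ' (max R₁ R₂)
  have hrem : (fun ω => φ (a ω + v ω) - ∑ n ∈ Finset.range (Q + 1),
      (n.factorial : ℝ)⁻¹ • iteratedFDeriv ℝ n φ (a ω) fun _ => v ω)
      =O[l] fun ω => δ ω ^ (Q + 1) := by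
    refine IsBigO.trans ?_ (hvδ.norm_left.pow (Q + 1))
    refine IsBigO.of_bound K ?_
    filter_upwards [hR₁ _ (le_max_left R₁ R₂), hR₂ _ (le_max_right R₁ R₂)] with ω h1 h2
    rw [norm_pow, norm_norm]
    exact norm_sub_taylor_le hφ (convex_closedBall _ _) hK h1 h2
  -- After multilinear expansion, grouping the tuples by their underlying forest leaves exactly
  -- those with more than Q vertices.
  have hexp : ∀ ω, (∑ n ∈ Finset.range (Q + 1),
      (n.factorial : ℝ)⁻¹ • iteratedFDeriv ℝ n φ (a ω) fun _ => v ω) -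
        ∑ h ∈ forestsUpTo d Q, (h.map (μ ω)).prod • taylorCoeff Q φ (a ω) (W ω) h =
      ∑ n ∈ Finset.range (Q + 1),
        ∑ g ∈ (Fintype.piFinset fun _ : Fin n => treesUpTo d Q) with
          Finset.univ.val.map g ∉ forestsUpTo d Q,
          ((Finset.univ.val.map g).map (μ ω)).prod •
            (n.factorial : ℝ)⁻¹ • iteratedFDeriv ℝ n φ (a ω) fun j => W ω (g j) := by
    intro ω
    have h2 : ∑ h ∈ forestsUpTo d Q, (h.map (μ ω)).prod • taylorCoeff Q φ (a ω) (W ω) h =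
        ∑ n ∈ Finset.range (Q + 1),
        ∑ g ∈ (Fintype.piFinset fun _ : Fin n => treesUpTo d Q) with
          Finset.univ.val.map g ∈ forestsUpTo d Q,
          ((Finset.univ.val.map g).map (μ ω)).prod •
            (n.factorial : ℝ)⁻¹ • iteratedFDeriv ℝ n φ (a ω) fun j => W ω (g j) := by
      simp only [taylorCoeff, Finset.smul_sum]
      rw [Finset.sum_comm]
      refine Finset.sum_congr rfl fun n _ => ?_
      rw [← Finset.sum_fiberwise_eq_sum_filter]
      refine Finset.sum_congr rfl fun h _ => Finset.sum_congr rfl fun g hg => ?_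
      rw [(Finset.mem_filter.1 hg).2]
    rw [h2, sub_eq_iff_eq_add, ← Finset.sum_add_distrib]
    refine Finset.sum_congr rfl fun n _ => ?_
    rw [add_comm, Finset.sum_filter_add_sum_filter_not]
    have : (fun _ : Fin n => v ω) = fun j : Fin n => ∑ τ ∈ treesUpTo d Q, μ ω τ • W ω τ := rfl
    rw [this, ContinuousMultilinearMap.map_sum_finset, Finset.smul_sum]
    refine Finset.sum_congr rfl fun g _ => ?_
    rw [ContinuousMultilinearMap.map_smul_univ, smul_comm, Multiset.map_map]
    rfl
  have hsum : (fun ω => (∑ n ∈ Finset.range (Q + 1),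
      (n.factorial : ℝ)⁻¹ • iteratedFDeriv ℝ n φ (a ω) fun _ => v ω) -
        ∑ h ∈ forestsUpTo d Q, (h.map (μ ω)).prod • taylorCoeff Q φ (a ω) (W ω) h)
      =O[l] fun ω => δ ω ^ (Q + 1) := by
    simp only [hexp]
    refine IsBigO.fun_sum fun n hn => IsBigO.fun_sum fun g hg => ?_
    rw [Finset.mem_filter, mem_forestsUpTo, not_le, Fintype.mem_piFinset] at hg
    have h1 := (isBigO_forest_prod hμ (Finset.univ.val.map g)).trans
      (isBigO_pow_of_le hδ (Nat.succ_le_of_lt hg.2))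
    have hD : (fun ω => iteratedFDeriv ℝ n φ (a ω)) =O[l] fun _ => (1 : ℝ) :=
      isBigO_comp_of_continuous (hφ.continuous_iteratedFDeriv (by
        have := Finset.mem_range.1 hn
        exact_mod_cast (by omega : n ≤ Q))) ha
    have hP : (fun ω => ∏ j, ‖W ω (g j)‖) =O[l] fun _ => (1 : ℝ) := by
      simpa using IsBigO.finsetProd (s := Finset.univ) (f := fun (j : Fin n) ω => ‖W ω (g j)‖)
        (g := fun _ _ => (1 : ℝ)) fun j _ => (hW _ (hg.1 j)).norm_left
    have h2 : (fun ω => iteratedFDeriv ℝ n φ (a ω) fun j => W ω (g j)) =O[l] fun _ => (1 : ℝ) := by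
      refine IsBigO.trans (g := fun ω => ‖iteratedFDeriv ℝ n φ (a ω)‖ * ∏ j, ‖W ω (g j)‖) ?_
        (by simpa using hD.norm_left.mul hP)
      exact IsBigO.of_norm_le fun ω => (iteratedFDeriv ℝ n φ (a ω)).le_opNorm _
    simpa using h1.smul (h2.const_smul_left (n.factorial : ℝ)⁻¹)
  refine (hrem.add hsum).congr_left fun ω => ?_
  abel

/-- If two combinations of trees agree up to `δ ^ (Q + 1)`, so do the expansions of a function
along them. -/
theorem isBigO_taylorCoeff_sub_taylorCoeff {Q : ℕ} {φ : E → E} (hφ : ContDiff ℝ (Q : ℕ∞) φ)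
    (hφ' : LocallyLipschitz (iteratedFDeriv ℝ Q φ))
    {δ : ι → ℝ} (hδ : δ =O[l] fun _ => (1 : ℝ)) {a b : ι → E} (ha : a =O[l] fun _ => (1 : ℝ))
    (hb : b =O[l] fun _ => (1 : ℝ)) {μ ν : ι → Tree d → ℝ}
    (hμ : ∀ τ, (fun ω => μ ω τ) =O[l] fun ω => δ ω ^ τ.size)
    (hν : ∀ τ, (fun ω => ν ω τ) =O[l] fun ω => δ ω ^ τ.size)
    {V W : ι → Tree d → E} (hV : ∀ τ ∈ treesUpTo d Q, (fun ω => V ω τ) =O[l] fun _ => (1 : ℝ))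
    (hW : ∀ τ ∈ treesUpTo d Q, (fun ω => W ω τ) =O[l] fun _ => (1 : ℝ))
    (hab : (fun ω => (b ω + ∑ τ ∈ treesUpTo d Q, μ ω τ • W ω τ) -
      (a ω + ∑ τ ∈ treesUpTo d Q, ν ω τ • V ω τ)) =O[l] fun ω => δ ω ^ (Q + 1)) :
    (fun ω => (∑ h ∈ forestsUpTo d Q, (h.map (μ ω)).prod • taylorCoeff Q φ (b ω) (W ω) h) -
      ∑ h ∈ forestsUpTo d Q, (h.map (ν ω)).prod • taylorCoeff Q φ (a ω) (V ω) h)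
      =O[l] fun ω => δ ω ^ (Q + 1) := by
  have h1 := isBigO_sub_sum_taylorCoeff hφ hφ' hδ hb hμ hW
  have h2 := isBigO_sub_sum_taylorCoeff hφ hφ' hδ ha hν hV
  obtain ⟨R₁, hR₁⟩ := exists_eventually_mem_closedBall
    (hb.add ((isBigO_sum_trees hδ hμ hW).trans hδ))
  obtain ⟨R₂, hR₂⟩ := exists_eventually_mem_closedBall
    (ha.add ((isBigO_sum_trees hδ hν hV).trans hδ))
  obtain ⟨K, hK⟩ := exists_lipschitzOnWith_iteratedFDeriv
    (locallyLipschitz_iteratedFDeriv hφ hφ' (Nat.zero_le Q)) (max R₁ R₂)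
  have h3 : (fun ω => φ (b ω + ∑ τ ∈ treesUpTo d Q, μ ω τ • W ω τ) -
      φ (a ω + ∑ τ ∈ treesUpTo d Q, ν ω τ • V ω τ)) =O[l] fun ω => δ ω ^ (Q + 1) := by
    refine IsBigO.trans (IsBigO.of_bound K ?_) hab
    filter_upwards [hR₁ _ (le_max_left R₁ R₂), hR₂ _ (le_max_right R₁ R₂)] with ω m1 m2
    exact norm_sub_le_of_lipschitzOnWith_iteratedFDeriv_zero hK m1 m2
  refine ((h3.sub h1).add h2).congr_left fun ω => ?_
  abel

end expansion

/-! ## Symmetry of the iterated derivatives -/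

section symmetry

variable {E F : Type*} [NormedAddCommGroup E] [NormedSpace ℝ E] [NormedAddCommGroup F]
  [NormedSpace ℝ F]

theorem fderiv_multilinear_apply {n : ℕ} {G : E → ContinuousMultilinearMap ℝ (fun _ : Fin n => E) F}
    {x : E} (hG : DifferentiableAt ℝ G x) (w : Fin n → E) (u : E) :
    fderiv ℝ (fun y => G y w) x u = fderiv ℝ G x u w := by
  have := (ContinuousMultilinearMap.apply ℝ (fun _ : Fin n => E) F w).hasFDerivAt.comp x
    hG.hasFDerivAt
  rw [show (fun y => G y w) = ContinuousMultilinearMap.apply ℝ (fun _ : Fin n => E) F w ∘ G from rfl,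
    this.fderiv]
  rfl

/-- Exchanging the first two slots is the symmetry of the second derivative of `iteratedFDeriv ℝ n
f`. An exchange further right only concerns the tail, so it follows by differentiating the identity
one order lower. The regularity N stays fixed so that the induction on n applies. -/
theorem iteratedFDeriv_comp_swap {f : E → F} {N : ℕ} (hf : ContDiff ℝ (N : ℕ∞) f) (n : ℕ)
    (hN : n + 1 ≤ N) (i : Fin n) (x : E) (v : Fin (n + 1) → E) :
    iteratedFDeriv ℝ (n + 1) f x (v ∘ Equiv.swap i.castSucc i.succ) =
      iteratedFDeriv ℝ (n + 1) f x v := by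
  induction n generalizing x with
  | zero => exact i.elim0
  | succ n ih =>
    have hd1 : Differentiable ℝ (iteratedFDeriv ℝ (n + 1) f) :=
      hf.differentiable_iteratedFDeriv (by exact_mod_cast hN)
    induction i using Fin.cases with
    | zero =>
      have hc2 : ContDiff ℝ ((2 : ℕ) : ℕ∞) (iteratedFDeriv ℝ n f) :=
        hf.iteratedFDeriv_right (by exact_mod_cast (by omega : 2 + n ≤ N))
      have hd2 : Differentiable ℝ (fderiv ℝ (iteratedFDeriv ℝ n f)) :=
        (hc2.fderiv_right (m := 1) (by norm_num)).differentiable (by norm_num)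
      have key : ∀ m : Fin (n + 2) → E, iteratedFDeriv ℝ (n + 2) f x m =
          fderiv ℝ (fderiv ℝ (iteratedFDeriv ℝ n f)) x (m 0) (m 1) (Fin.tail (Fin.tail m)) := by
        intro m
        rw [iteratedFDeriv_succ_apply_left, ← fderiv_multilinear_apply (hd1 x)]
        simp only [iteratedFDeriv_succ_apply_left]
        have h2 : HasFDerivAt (fun y => fderiv ℝ (iteratedFDeriv ℝ n f) y (Fin.tail m 0))
            ((fderiv ℝ (fderiv ℝ (iteratedFDeriv ℝ n f)) x).flip (Fin.tail m 0)) x :=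
          by
          simpa using (hd2 x).hasFDerivAt.clm_apply (hasFDerivAt_const (Fin.tail m 0) x)
        rw [fderiv_multilinear_apply h2.differentiableAt, h2.fderiv]
        rfl
      rw [key, key]
      have hs := (hc2.contDiffAt (x := x)).isSymmSndFDerivAt (by simp)
      rw [hs]
      congr 1
    | succ j =>
      rw [iteratedFDeriv_succ_apply_left, iteratedFDeriv_succ_apply_left]
      have h0 : (v ∘ Equiv.swap j.succ.castSucc j.succ.succ) 0 = v 0 := by
        rw [Function.comp_apply, Equiv.swap_apply_of_ne_of_ne]
        · rw [← Fin.succ_castSucc]; exact (Fin.succ_ne_zero _).symm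
        · exact (Fin.succ_ne_zero _).symm
      have ht : Fin.tail (v ∘ Equiv.swap j.succ.castSucc j.succ.succ) =
          Fin.tail v ∘ Equiv.swap j.castSucc j.succ := by
        ext k
        simp only [Fin.tail, Function.comp_apply]
        congr 1
        rw [← Fin.succ_castSucc]
        exact ((Fin.succ_injective _).map_swap _ _ _).symm
      rw [h0, ht, ← fderiv_multilinear_apply (hd1 x), ← fderiv_multilinear_apply (hd1 x)]
      have := fun y => ih (by omega) j y (Fin.tail v)
      simp only [this]

theorem iteratedFDeriv_comp_perm {f : E → F} {n : ℕ} (hf : ContDiff ℝ (n : ℕ∞) f) (x : E)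
    (v : Fin n → E) (σ : Equiv.Perm (Fin n)) :
    iteratedFDeriv ℝ n f x (v ∘ σ) = iteratedFDeriv ℝ n f x v := by
  cases n with
  | zero => congr 1; ext i; exact i.elim0
  | succ n =>
    have hσ : σ ∈ Submonoid.closure
        (Set.range fun i : Fin n => Equiv.swap i.castSucc i.succ) := by
      rw [Equiv.Perm.mclosure_swap_castSucc_succ]; trivial
    induction hσ using Submonoid.closure_induction generalizing v with
    | mem σ hσ =>
      obtain ⟨i, rfl⟩ := hσ
      exact iteratedFDeriv_comp_swap hf n le_rfl i x v
    | one => rfl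
    | mul σ τ _ _ h1 h2 =>
      rw [Equiv.Perm.coe_mul, ← Function.comp_assoc, h2, h1]

end symmetry

/-! ## Orderings of a multiset -/

theorem exists_perm_of_map_eq {β : Type*} {n : ℕ} {g g₀ : Fin n → β}
    (h : Finset.univ.val.map g = Finset.univ.val.map g₀) : ∃ σ : Equiv.Perm (Fin n), g = g₀ ∘ σ := by
  classical
  have hcard : ∀ c, Fintype.card {i // g i = c} = Fintype.card {i // g₀ i = c} := by
    intro c
    have := congrArg (Multiset.count c) h
    rw [Multiset.count_map, Multiset.count_map] at this
    rw [Fintype.card_subtype, Fintype.card_subtype]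
    simp only [eq_comm (b := c)]
    exact this
  exact ⟨Equiv.ofFiberEquiv fun c => Fintype.equivOfCardEq (hcard c), funext fun i =>
    (Equiv.ofFiberEquiv_map _ i).symm⟩

-- Orbit–stabiliser: permutations of the n slots act transitively on the orderings, and each fibre
-- of σ ↦ g₀ ∘ σ is a coset of the stabiliser, which permutes equal entries.
open Classical in
theorem card_orderings_mul {β : Type*} {n : ℕ} (g₀ : Fin n → β) (S : Finset (Fin n → β))
    (hS : ∀ g, g ∈ S ↔ Finset.univ.val.map g = Finset.univ.val.map g₀) :
    S.card * ∏ c ∈ (Finset.univ.val.map g₀).toFinset,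
      ((Finset.univ.val.map g₀).count c).factorial = n.factorial := by
  have hcomp : ∀ σ : Equiv.Perm (Fin n),
      Finset.univ.val.map (g₀ ∘ σ) = Finset.univ.val.map g₀ := fun σ => by
    rw [← Multiset.map_map, ← Finset.map_univ_equiv σ]
    simp
  have h1 := Finset.card_eq_sum_card_fiberwise (s := (Finset.univ : Finset (Equiv.Perm (Fin n))))
    (t := S) (f := fun σ : Equiv.Perm (Fin n) => g₀ ∘ σ)
    (fun σ _ => (hS _).2 (hcomp σ))
  rw [Finset.card_univ, Fintype.card_perm, Fintype.card_fin] at h1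
  rw [h1, ← smul_eq_mul, ← Finset.sum_const]
  refine Finset.sum_congr rfl fun g hg => ?_
  obtain ⟨σ₀, rfl⟩ := exists_perm_of_map_eq ((hS g).1 hg)
  have h2 : (Finset.univ.filter fun σ : Equiv.Perm (Fin n) => g₀ ∘ σ = g₀ ∘ σ₀).card =
      Fintype.card {σ : Equiv.Perm (Fin n) // g₀ ∘ σ = g₀} := by
    rw [Fintype.card_subtype]
    refine Finset.card_bij (fun σ _ => σ * σ₀⁻¹) ?_ ?_ ?_
    · intro σ hσ
      simp only [Finset.mem_filter, Finset.mem_univ, true_and] at hσ ⊢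
      rw [Equiv.Perm.coe_mul, ← Function.comp_assoc, hσ]
      ext i; simp
    · intro σ _ σ' _ h; exact mul_right_cancel h
    · intro σ hσ
      simp only [Finset.mem_filter, Finset.mem_univ, true_and] at hσ ⊢
      exact ⟨σ * σ₀, by rw [Equiv.Perm.coe_mul, ← Function.comp_assoc, hσ], by simp⟩
  rw [h2, DomMulAct.stabilizer_card']
  refine Finset.prod_congr ?_ fun c _ => ?_
  · ext c; simp
  · congr 1
    rw [Multiset.count_map, Fintype.card_subtype]
    simp only [eq_comm (a := c)]
    rfl

/-! ## Taylor coefficients and elementary differentials -/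

section taylorCoeff

variable {d : ℕ} {E : Type*} [NormedAddCommGroup E] [NormedSpace ℝ E]

theorem taylorCoeff_congr {Q : ℕ} {φ : E → E} {a : E} {V W : Tree d → E} {h : Forest d}
    (hVW : ∀ τ ∈ h, V τ = W τ) : taylorCoeff Q φ a V h = taylorCoeff Q φ a W h := by
  classical
  refine Finset.sum_congr rfl fun n _ => Finset.sum_congr rfl fun g hg => ?_
  congr 2
  ext j
  refine hVW _ ?_
  rw [← (Finset.mem_filter.1 hg).2]
  exact Multiset.mem_map_of_mem _ (Finset.mem_univ_val _)

-- By symmetry all orderings of a forest contribute equally. Counting them replaces the 1/n! of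
-- Taylor's formula by the product of the 1/r_j!, the source of the multiplicities in σ.
open Classical in
theorem taylorCoeff_map {Q : ℕ} {φ : E → E} (hφ : ContDiff ℝ (Q : ℕ∞) φ) (a : E) (W : Tree d → E)
    {n : ℕ} (g₀ : Fin n → Tree d) (hg₀ : Forest.size (Finset.univ.val.map g₀) ≤ Q) :
    taylorCoeff Q φ a W (Finset.univ.val.map g₀) =
      ((∏ c ∈ (Finset.univ.val.map g₀).toFinset,
        ((Finset.univ.val.map g₀).count c).factorial : ℕ) : ℝ)⁻¹ •
        iteratedFDeriv ℝ n φ a fun j => W (g₀ j) := by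
  have hn : n ≤ Q := by
    have := (Forest.card_le_size (Finset.univ.val.map g₀)).trans hg₀
    simpa using this
  unfold taylorCoeff
  rw [Finset.sum_eq_single n]
  · set S : Finset (Fin n → Tree d) :=
      (Fintype.piFinset fun _ : Fin n => treesUpTo d Q).filter
        (fun g => Finset.univ.val.map g = Finset.univ.val.map g₀) with hSdef
    have hS : ∀ g, g ∈ S ↔ Finset.univ.val.map g = Finset.univ.val.map g₀ := by
      intro g
      rw [hSdef, Finset.mem_filter, and_iff_right_iff_imp, Fintype.mem_piFinset]
      intro hg j
      rw [mem_treesUpTo]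
      refine (Tree.size_le_forest (h := Finset.univ.val.map g) ?_).trans (hg ▸ hg₀)
      exact Multiset.mem_map_of_mem _ (Finset.mem_univ_val _)
    have hterm : ∀ g ∈ S, ((n.factorial : ℝ)⁻¹ • iteratedFDeriv ℝ n φ a fun j => W (g j)) =
        (n.factorial : ℝ)⁻¹ • iteratedFDeriv ℝ n φ a fun j => W (g₀ j) := by
      intro g hg
      obtain ⟨σ, rfl⟩ := exists_perm_of_map_eq ((hS g).1 hg)
      congr 1
      exact iteratedFDeriv_comp_perm (hφ.of_le (by exact_mod_cast hn)) a (fun j => W (g₀ j)) σ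
    rw [Finset.sum_congr rfl hterm, Finset.sum_const, ← Nat.cast_smul_eq_nsmul ℝ, smul_smul]
    congr 1
    have hcard := card_orderings_mul g₀ S hS
    have h0 : ((∏ c ∈ (Finset.univ.val.map g₀).toFinset,
        ((Finset.univ.val.map g₀).count c).factorial : ℕ) : ℝ) ≠ 0 := by
      exact_mod_cast Finset.prod_ne_zero_iff.2 fun c _ => Nat.factorial_ne_zero _
    have h1 : (n.factorial : ℝ) ≠ 0 := by exact_mod_cast Nat.factorial_ne_zero n
    rw [← div_eq_mul_inv, div_eq_iff h1, eq_inv_mul_iff_mul_eq₀ h0, mul_comm]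
    exact_mod_cast hcard
  · intro k _ hk
    refine Finset.sum_eq_zero fun g hg => absurd ?_ hk
    simpa using congrArg Multiset.card (Finset.mem_filter.1 hg).2
  · intro h
    exact absurd (Finset.mem_range.2 (Nat.lt_succ_of_le hn)) h

theorem univ_val_map_toList_get (h : Forest d) :
    Finset.univ.val.map (fun j => h.toList.get j) = h := by
  rw [Fin.univ_val_map, List.ofFn_get, Multiset.coe_toList]

theorem taylorCoeff_zero {Q : ℕ} {φ : E → E} (hφ : ContDiff ℝ (Q : ℕ∞) φ) (a : E)
    (W : Tree d → E) : taylorCoeff Q φ a W 0 = φ a := by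
  have := taylorCoeff_map hφ a W (Fin.elim0 : Fin 0 → Tree d) (by simp)
  simpa using this

end taylorCoeff

section elemDiff

variable {d m : ℕ}

theorem elemDiff_graft (f : Fin d → EuclideanSpace ℝ (Fin m) → EuclideanSpace ℝ (Fin m))
    (i : Fin d) (h : Forest d) (y : EuclideanSpace ℝ (Fin m)) :
    elemDiff f (Tree.graft i h) y =
      iteratedFDeriv ℝ h.toList.length (f i) y fun j => elemDiff f (h.toList.get j) y := by
  rw [elemDiff, Tree.branches_graft, Tree.root_graft]

open Classical in
theorem symmFactor_graft (i : Fin d) (h : Forest d) :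
    (Tree.graft i h).symmFactor =
      (∏ c ∈ h.toFinset, (h.count c).factorial) * (h.map Tree.symmFactor).prod := by
  rw [Tree.symmFactor, Tree.branches_graft]
  congr 1
  rw [Multiset.attach_map_val']

/-- The coefficient `F(τ)(y) / σ(τ)` of `τ` in the B-series of `f`. -/
noncomputable def elemCoeff (f : Fin d → EuclideanSpace ℝ (Fin m) → EuclideanSpace ℝ (Fin m))
    (y : EuclideanSpace ℝ (Fin m)) (τ : Tree d) : EuclideanSpace ℝ (Fin m) :=
  (1 / (τ.symmFactor : ℝ)) • elemDiff f τ y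

/-- Composing f_i with a B-series shifts its coefficients by grafting: the elementary differential
matches the derivative in the Taylor coefficient, and the symmetry factor its multiplicities. -/
theorem taylorCoeff_elemCoeff
    {f : Fin d → EuclideanSpace ℝ (Fin m) → EuclideanSpace ℝ (Fin m)} {Q : ℕ} {i : Fin d}
    (hf : ContDiff ℝ (Q : ℕ∞) (f i)) (y : EuclideanSpace ℝ (Fin m)) {h : Forest d}
    (hh : Forest.size h ≤ Q) :
    taylorCoeff Q (f i) y (elemCoeff f y) h = elemCoeff f y (Tree.graft i h) := by
  classical
  have key := taylorCoeff_map hf y (elemCoeff f y) (fun j => h.toList.get j)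
    (by rwa [univ_val_map_toList_get])
  rw [univ_val_map_toList_get] at key
  rw [key]
  simp only [elemCoeff]
  rw [ContinuousMultilinearMap.map_smul_univ, elemDiff_graft, symmFactor_graft, smul_smul]
  congr 1
  have : (∏ j, 1 / ((h.toList.get j).symmFactor : ℝ)) =
      1 / (((h.map Tree.symmFactor).prod : ℕ) : ℝ) := by
    conv_rhs => rw [← univ_val_map_toList_get h]
    rw [Multiset.map_map]
    simp only [one_div, Finset.prod_inv_distrib]
    congr 1
    exact_mod_cast rfl
  rw [this, Nat.cast_mul, one_div, one_div, mul_inv]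

/-- A vertex of a tree with n vertices has at most n - 1 branches, so trees with P + 1 vertices
still involve only derivatives up to order P. -/
theorem continuous_elemDiff {f : Fin d → EuclideanSpace ℝ (Fin m) → EuclideanSpace ℝ (Fin m)}
    {P : ℕ} (hf : ∀ i, ContDiff ℝ (P : ℕ∞) (f i)) (n : ℕ) : ∀ τ : Tree d, τ.size = n → n ≤ P + 1 →
    Continuous (elemDiff f τ) := by
  induction n using Nat.strong_induction_on with
  | _ n ih =>
    intro τ hτ hn
    obtain ⟨i, h, rfl⟩ : ∃ i h, τ = Tree.graft i h := ⟨_, _, τ.graft_root_branches.symm⟩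
    have hb : ∀ j, Continuous (elemDiff f (h.toList.get j)) := by
      intro j
      have hlt : (h.toList.get j).size < n := hτ ▸ Tree.size_lt (by
        rw [Tree.branches_graft]; exact Multiset.mem_toList.1 (List.get_mem _ _))
      exact ih _ hlt _ rfl (by omega)
    have hlen : h.toList.length ≤ P := by
      rw [Multiset.length_toList]
      have := Forest.card_le_size h
      rw [Tree.size_graft] at hτ
      omega
    have hc := (hf i).continuous_iteratedFDeriv (m := h.toList.length) (by exact_mod_cast hlen)
    rw [show elemDiff f (Tree.graft i h) = _ from funext (elemDiff_graft f i h)]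
    exact hc.eval (continuous_pi hb)

open Classical in
/-- For a path without components along products of trees, composition is given by the Taylor
coefficients. -/
theorem compose_eq_taylorCoeff {α : ℝ} {φ : EuclideanSpace ℝ (Fin m) → EuclideanSpace ℝ (Fin m)}
    (hφ : ContDiff ℝ ((levels α - 1 : ℕ) : ℕ∞) φ) {Z : Forest d → EuclideanSpace ℝ (Fin m)}
    (hZ : ∀ h ∈ forestsUpTo d (levels α - 1), 2 ≤ Multiset.card h → Z h = 0) (h : Forest d) :
    compose α φ Z h = taylorCoeff (levels α - 1) φ (Z 0) (fun τ => Z {τ}) h := by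
  set L := levels α - 1
  by_cases h0 : h = 0
  · rw [h0, taylorCoeff_zero hφ]; simp [compose]
  rw [compose, if_neg h0]
  have hsub : Finset.Icc 1 L ⊆ Finset.range (L + 1) := fun n hn =>
    Finset.mem_range.2 (Nat.lt_succ_of_le (Finset.mem_Icc.1 hn).2)
  refine Eq.trans ?_ (Finset.sum_subset hsub fun n hn hn' => ?_)
  · refine Finset.sum_congr rfl fun n _ => Eq.symm ?_
    have hsum : ∀ g : Fin n → Tree d, ∑ j, ({g j} : Forest d) = Finset.univ.val.map g := by
      intro g
      rw [← Multiset.sum_map_singleton (Finset.univ.val.map g), Multiset.map_map]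
      rfl
    refine Finset.sum_of_injOn (fun (g : Fin n → Tree d) j => ({g j} : Forest d)) ?_ ?_ ?_ ?_
    · intro g _ g' _ hgg
      ext j
      exact Multiset.singleton_inj.1 (congrFun hgg j)
    · intro g hg
      simp only [Finset.coe_filter, Set.mem_ofPred_eq, Fintype.mem_piFinset, Finset.mem_erase,
        mem_treesUpTo, mem_forestsUpTo, Forest.size_singleton] at hg ⊢
      exact ⟨fun j => ⟨Multiset.singleton_ne_zero _, hg.1 j⟩, by rw [hsum, hg.2]⟩
    · intro g hg hne
      simp only [Finset.mem_filter, Fintype.mem_piFinset, Finset.mem_erase] at hg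
      -- A tuple of forests that does not come from a tuple of trees contains a product of at least
      -- two trees. There Z vanishes, and so does the multilinear term.
      obtain ⟨j, hj⟩ : ∃ j, 2 ≤ Multiset.card (g j) := by
        by_contra! hcon
        apply hne
        have h1 : ∀ j, ∃ τ, g j = {τ} := fun j => Multiset.card_eq_one.1 (by
          have := Multiset.card_pos.2 (hg.1 j).1
          have := hcon j
          omega)
        choose τ hτ using h1
        have hgτ : g = fun j => {τ j} := funext hτ
        refine ⟨τ, ?_, hgτ.symm⟩
        simp only [Finset.coe_filter, Set.mem_ofPred_eq, Fintype.mem_piFinset]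
        refine ⟨fun j => ?_, by rw [← hsum, ← hg.2, hgτ]⟩
        have := mem_forestsUpTo.1 (hg.1 j).2
        rwa [hτ j, Forest.size_singleton, ← mem_treesUpTo] at this
      rw [ContinuousMultilinearMap.map_coord_zero _ j (hZ _ (hg.1 j).2 hj), smul_zero]
    · intro g _; rfl
  -- The only order absent from `compose` is 0, whose empty tuple yields the empty forest, excluded
  -- here.
  · have : n = 0 := by
      rw [Finset.mem_Icc] at hn'
      have := Finset.mem_range.1 hn
      omega
    subst this
    refine Finset.sum_eq_zero fun g hg => absurd ?_ h0
    rw [← (Finset.mem_filter.1 hg).2]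
    simp

end elemDiff

/-! ## Dyadic sums and sewing -/

section sewing

variable {E : Type*} [NormedAddCommGroup E]

/-- The sum of a two-parameter function over the dyadic partition of `[s, t]` into `2 ^ n`
intervals. -/
noncomputable def dyadicSum (Ξ : ℝ → ℝ → E) : ℕ → ℝ → ℝ → E
  | 0, s, t => Ξ s t
  | n + 1, s, t => dyadicSum Ξ n s ((s + t) / 2) + dyadicSum Ξ n ((s + t) / 2) t

theorem dyadicSum_add (Ξ Θ : ℝ → ℝ → E) (n : ℕ) (s t : ℝ) :
    dyadicSum (fun s t => Ξ s t + Θ s t) n s t = dyadicSum Ξ n s t + dyadicSum Θ n s t := by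
  induction n generalizing s t with
  | zero => rfl
  | succ n ih => simp only [dyadicSum, ih]; abel

theorem dyadicSum_sum {κ : Type*} (S : Finset κ) (Ξ : κ → ℝ → ℝ → E) (n : ℕ) (s t : ℝ) :
    dyadicSum (fun s t => ∑ i ∈ S, Ξ i s t) n s t = ∑ i ∈ S, dyadicSum (Ξ i) n s t := by
  induction n generalizing s t with
  | zero => rfl
  | succ n ih => simp only [dyadicSum, ih, Finset.sum_add_distrib]

theorem dyadicSum_eq_sum (Ξ : ℝ → ℝ → E) (n : ℕ) (s t : ℝ) :
    dyadicSum Ξ n s t = ∑ k ∈ Finset.range (2 ^ n),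
      Ξ (s + k * ((t - s) / 2 ^ n)) (s + (k + 1 : ℕ) * ((t - s) / 2 ^ n)) := by
  induction n generalizing s t with
  | zero => simp [dyadicSum]
  | succ n ih =>
    rw [dyadicSum, ih, ih, pow_succ, mul_two, Finset.sum_range_add]
    have h2 : (2 : ℝ) ^ n ≠ 0 := by positivity
    congr 1
    · refine Finset.sum_congr rfl fun k _ => ?_
      congr 1 <;> field_simp <;> ring
    · refine Finset.sum_congr rfl fun k _ => ?_
      congr 1 <;> push_cast <;> field_simp <;> ring

theorem half_rpow_two {r : ℝ} (hr : 0 ≤ r) (θ : ℝ) : 2 * (r / 2) ^ θ = 2 ^ (1 - θ) * r ^ θ := by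
  rw [Real.div_rpow hr (by norm_num), Real.rpow_sub (by norm_num), Real.rpow_one]
  ring

variable {t₀ T θ C : ℝ}

/-- Each halving doubles the number of terms and divides the bound on each by 2^θ. -/
theorem norm_dyadicSum_le {D : ℝ → ℝ → E}
    (hD : ∀ s t, t₀ ≤ s → s < t → t ≤ T → ‖D s t‖ ≤ C * (t - s) ^ θ) (n : ℕ) :
    ∀ s t, t₀ ≤ s → s < t → t ≤ T →
      ‖dyadicSum D n s t‖ ≤ C * (2 ^ (1 - θ)) ^ n * (t - s) ^ θ := by
  induction n with
  | zero => simpa [dyadicSum] using hD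
  | succ n ih =>
    intro s t hs hst ht
    have h1 := ih s ((s + t) / 2) hs (by linarith) (by linarith)
    have h2 := ih ((s + t) / 2) t (by linarith) (by linarith) ht
    rw [show (s + t) / 2 - s = (t - s) / 2 by ring] at h1
    rw [show t - (s + t) / 2 = (t - s) / 2 by ring] at h2
    have h3 := half_rpow_two (sub_nonneg.2 hst.le) θ
    calc ‖dyadicSum D (n + 1) s t‖ ≤ _ := norm_add_le _ _
      _ ≤ C * (2 ^ (1 - θ)) ^ n * (2 * ((t - s) / 2) ^ θ) := by linarith
      _ = C * (2 ^ (1 - θ)) ^ (n + 1) * (t - s) ^ θ := by rw [h3]; ring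

theorem two_rpow_one_sub_lt_one (hθ : 1 < θ) : (2 : ℝ) ^ (1 - θ) < 1 :=
  Real.rpow_lt_one_of_one_lt_of_neg (by norm_num) (by linarith)

theorem tendsto_dyadicSum_zero (hθ : 1 < θ) {D : ℝ → ℝ → E}
    (hD : ∀ s t, t₀ ≤ s → s < t → t ≤ T → ‖D s t‖ ≤ C * (t - s) ^ θ) {s t : ℝ} (hs : t₀ ≤ s)
    (hst : s < t) (ht : t ≤ T) : Tendsto (fun n => dyadicSum D n s t) atTop (𝓝 0) := by
  refine squeeze_zero_norm (fun n => norm_dyadicSum_le hD n s t hs hst ht) ?_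
  have := (tendsto_pow_atTop_nhds_zero_of_lt_one (by positivity)
    (two_rpow_one_sub_lt_one hθ)).const_mul C |>.mul_const ((t - s) ^ θ)
  simpa using this

/-- The constant is the fixed point of x ↦ 2^(1-θ) x + C: one refinement reproduces the bound on
both halves and adds one midpoint error. -/
theorem norm_dyadicSum_sub_le (hθ : 1 < θ) {Ξ : ℝ → ℝ → E}
    (hΞ : ∀ s t, t₀ ≤ s → s < t → t ≤ T →
      ‖Ξ s t - Ξ s ((s + t) / 2) - Ξ ((s + t) / 2) t‖ ≤ C * (t - s) ^ θ) (n : ℕ) :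
    ∀ s t, t₀ ≤ s → s < t → t ≤ T →
      ‖dyadicSum Ξ n s t - Ξ s t‖ ≤ C / (1 - 2 ^ (1 - θ)) * (t - s) ^ θ := by
  have hq := two_rpow_one_sub_lt_one hθ
  induction n with
  | zero =>
    intro s t hs hst ht
    have hpos : 0 < (t - s) ^ θ := Real.rpow_pos_of_pos (sub_pos.2 hst) _
    have hC : 0 ≤ C := nonneg_of_mul_nonneg_left ((norm_nonneg _).trans (hΞ s t hs hst ht)) hpos
    simp only [dyadicSum, sub_self, norm_zero]
    exact mul_nonneg (div_nonneg hC (by linarith)) hpos.le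
  | succ n ih =>
    intro s t hs hst ht
    have h1 := ih s ((s + t) / 2) hs (by linarith) (by linarith)
    have h2 := ih ((s + t) / 2) t (by linarith) (by linarith) ht
    have h0 := hΞ s t hs hst ht
    rw [show (s + t) / 2 - s = (t - s) / 2 by ring] at h1
    rw [show t - (s + t) / 2 = (t - s) / 2 by ring] at h2
    have h3 := half_rpow_two (sub_nonneg.2 hst.le) θ
    have hsplit : dyadicSum Ξ (n + 1) s t - Ξ s t =
        (dyadicSum Ξ n s ((s + t) / 2) - Ξ s ((s + t) / 2)) +
        (dyadicSum Ξ n ((s + t) / 2) t - Ξ ((s + t) / 2) t) -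
        (Ξ s t - Ξ s ((s + t) / 2) - Ξ ((s + t) / 2) t) := by
      simp only [dyadicSum]; abel
    rw [hsplit]
    set q : ℝ := 2 ^ (1 - θ)
    have hq' : 1 - q ≠ 0 := by linarith
    calc _ ≤ _ := (norm_sub_le _ _).trans (add_le_add_left (norm_add_le _ _) _)
      _ ≤ C / (1 - q) * (2 * ((t - s) / 2) ^ θ) + C * (t - s) ^ θ := by linarith
      _ = C / (1 - q) * (t - s) ^ θ := by rw [h3]; field_simp; ring

/-- If the dyadic sums of `Ξ` converge to the increments of `y` and `Ξ` is additive up to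
`(t - s) ^ θ` with `θ > 1`, then `Ξ` approximates the increments of `y` to that order. -/
theorem norm_sub_le_of_tendsto_dyadicSum (hθ : 1 < θ) {Ξ : ℝ → ℝ → E} {y : ℝ → E}
    (hΞ : ∀ s t, t₀ ≤ s → s < t → t ≤ T →
      ‖Ξ s t - Ξ s ((s + t) / 2) - Ξ ((s + t) / 2) t‖ ≤ C * (t - s) ^ θ)
    {s t : ℝ} (hs : t₀ ≤ s) (hst : s < t) (ht : t ≤ T)
    (hy : Tendsto (fun n => dyadicSum Ξ n s t) atTop (𝓝 (y t - y s))) :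
    ‖y t - y s - Ξ s t‖ ≤ C / (1 - 2 ^ (1 - θ)) * (t - s) ^ θ :=
  le_of_tendsto (hy.sub_const (Ξ s t)).norm
    (Eventually.of_forall fun n => norm_dyadicSum_sub_le hθ hΞ n s t hs hst ht)

end sewing

theorem IsRoughIntegral.tendsto_dyadicSum {d m : ℕ} {α : ℝ} {X : ℝ → ℝ → Module.Dual ℝ (CK d)}
    {Z : ℝ → Forest d → EuclideanSpace ℝ (Fin m)} {i : Fin d} {s t : ℝ}
    {L : EuclideanSpace ℝ (Fin m)} (h : IsRoughIntegral α X Z i s t L) (hst : s < t) :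
    Tendsto (fun n => dyadicSum (localIntegral α X Z i) n s t) atTop (𝓝 L) := by
  rw [Metric.tendsto_atTop]
  intro ε hε
  obtain ⟨δ, hδ, H⟩ := h ε hε
  obtain ⟨n₀, hn₀⟩ := exists_nat_gt ((t - s) / δ)
  refine ⟨n₀, fun n hn => ?_⟩
  have h2 : (0 : ℝ) < 2 ^ n := by positivity
  have hlt : (t - s) / 2 ^ n < δ := by
    rw [div_lt_iff₀ h2, mul_comm, ← div_lt_iff₀ hδ]
    refine hn₀.trans_le ?_
    have h3 : n₀ ≤ 2 ^ n := hn.trans (Nat.lt_two_pow_self).le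
    exact_mod_cast h3
  have hpos : 0 < (t - s) / 2 ^ n := div_pos (sub_pos.2 hst) h2
  rw [dist_eq_norm, dyadicSum_eq_sum]
  refine H (2 ^ n) (fun k => s + k * ((t - s) / 2 ^ n)) (by simp) ?_ fun k _ => ?_
  · push_cast; field_simp; ring
  · push_cast
    constructor <;> linarith

/-! ## Sums over trees and forests -/

section sums

variable {d : ℕ} {E : Type*} [AddCommMonoid E]

theorem sum_treesUpTo_succ (Q : ℕ) (G : Tree d → E) :
    ∑ τ ∈ treesUpTo d (Q + 1), G τ = ∑ i, ∑ h ∈ forestsUpTo d Q, G (Tree.graft i h) := by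
  rw [← Finset.sum_product']
  refine Finset.sum_nbij' (fun τ => (τ.root, τ.branches)) (fun q => Tree.graft q.1 q.2) ?_ ?_ ?_ ?_ ?_
  · intro τ hτ
    rw [mem_treesUpTo, Tree.size_eq] at hτ
    simp only [Finset.mem_product, Finset.mem_univ, true_and, mem_forestsUpTo]
    omega
  · intro q hq
    simp only [Finset.mem_product, Finset.mem_univ, true_and, mem_forestsUpTo] at hq
    rw [mem_treesUpTo, Tree.size_graft]
    omega
  · intro τ _; simp
  · intro q _; simp
  · intro τ _; simp

theorem sum_forestsUpTo_eq (Q : ℕ) (G : Forest d → E)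
    (hG : ∀ h ∈ forestsUpTo d Q, 2 ≤ Multiset.card h → G h = 0) :
    ∑ h ∈ forestsUpTo d Q, G h = G 0 + ∑ τ ∈ treesUpTo d Q, G {τ} := by
  classical
  rw [← Finset.add_sum_erase _ _ (show (0 : Forest d) ∈ forestsUpTo d Q by simp [mem_forestsUpTo])]
  congr 1
  symm
  refine Finset.sum_of_injOn (fun τ => ({τ} : Forest d)) ?_ ?_ ?_ ?_
  · intro τ _ τ' _ h
    exact Multiset.singleton_inj.1 h
  · intro τ hτ
    simpa [mem_forestsUpTo, mem_treesUpTo] using hτ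
  · intro h hh hne
    rw [Finset.mem_erase] at hh
    refine hG h hh.2 ?_
    by_contra hcon
    have := Multiset.card_pos.2 hh.1
    obtain ⟨τ, rfl⟩ := Multiset.card_eq_one.1 (by omega : Multiset.card h = 1)
    refine hne ⟨τ, ?_, rfl⟩
    simpa [mem_forestsUpTo, mem_treesUpTo] using hh.2
  · intro τ _; rfl

end sums

theorem convolve_one {d : ℕ} (φ ψ : Module.Dual ℝ (CK d)) : convolve φ ψ 1 = φ 1 * ψ 1 := by
  rw [convolve_apply, map_one, Algebra.TensorProduct.one_def]
  simp

/-! ## Ordered pairs of times -/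

/-- The pairs `t₀ ≤ s < t ≤ T`. -/
def timePairs (t₀ T : ℝ) : Set (ℝ × ℝ) := {ω | t₀ ≤ ω.1 ∧ ω.1 < ω.2 ∧ ω.2 ≤ T}

/-- The scale `(t - s) ^ α` of a pair of times. -/
noncomputable def scale (α : ℝ) (ω : ℝ × ℝ) : ℝ := (ω.2 - ω.1) ^ α

section scale

variable {α t₀ T : ℝ}

theorem scale_pos {ω : ℝ × ℝ} (hω : ω ∈ timePairs t₀ T) : 0 < scale α ω :=
  Real.rpow_pos_of_pos (sub_pos.2 hω.2.1) _

theorem scale_pow {ω : ℝ × ℝ} (hω : ω ∈ timePairs t₀ T) (n : ℕ) :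
    scale α ω ^ n = (ω.2 - ω.1) ^ ((n : ℝ) * α) := by
  rw [scale, mul_comm, Real.rpow_mul_natCast (sub_pos.2 hω.2.1).le]

/-- Along a principal filter, `=O` means a bound with one constant for all pairs of times, including
distant ones; boundedness of the scale is therefore needed explicitly. -/
theorem isBigO_scale (hα : 0 < α) : scale α =O[𝓟 (timePairs t₀ T)] fun _ => (1 : ℝ) := by
  refine IsBigO.of_bound ((T - t₀) ^ α) (eventually_principal.2 fun ω hω => ?_)
  rw [Real.norm_of_nonneg (scale_pos hω).le, norm_one, mul_one]
  exact Real.rpow_le_rpow (sub_pos.2 hω.2.1).le (by linarith [hω.1, hω.2.2]) hα.le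

theorem isBigO_scale_pow (hα : 0 < α) (n : ℕ) :
    (fun ω => scale α ω ^ n) =O[𝓟 (timePairs t₀ T)] fun _ => (1 : ℝ) := by
  simpa only [pow_zero] using isBigO_pow_of_le (isBigO_scale hα) (Nat.zero_le n)

theorem tendsto_left_half : Tendsto (fun ω : ℝ × ℝ => (ω.1, (ω.1 + ω.2) / 2))
    (𝓟 (timePairs t₀ T)) (𝓟 (timePairs t₀ T)) := by
  refine tendsto_principal_principal.2 fun ω ⟨h1, h2, h3⟩ => ⟨h1, ?_, ?_⟩ <;> simp only <;> linarith

theorem tendsto_right_half : Tendsto (fun ω : ℝ × ℝ => ((ω.1 + ω.2) / 2, ω.2))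
    (𝓟 (timePairs t₀ T)) (𝓟 (timePairs t₀ T)) := by
  refine tendsto_principal_principal.2 fun ω ⟨h1, h2, h3⟩ => ⟨?_, ?_, h3⟩ <;> simp only <;> linarith

theorem scale_right_half (ω : ℝ × ℝ) :
    scale α ((ω.1 + ω.2) / 2, ω.2) = scale α (ω.1, (ω.1 + ω.2) / 2) := by
  simp only [scale]; congr 1; ring

theorem isBigO_scale_left_half (hα : 0 < α) (n : ℕ) :
    (fun ω : ℝ × ℝ => scale α (ω.1, (ω.1 + ω.2) / 2) ^ n) =O[𝓟 (timePairs t₀ T)]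
      fun ω => scale α ω ^ n := by
  refine IsBigO.pow (IsBigO.of_bound 1 (eventually_principal.2 fun ω hω => ?_)) n
  have hω' := tendsto_principal_principal.1 tendsto_left_half ω hω
  rw [Real.norm_of_nonneg (scale_pos hω').le, Real.norm_of_nonneg (scale_pos hω).le, one_mul]
  exact Real.rpow_le_rpow (sub_pos.2 hω'.2.1).le (by simp only; linarith [hω.2.1]) hα.le

end scale

/-! ## Scaling of branched rough paths -/

namespace IsBranchedRoughPath

variable {d : ℕ} {α T t₀ : ℝ} {X : ℝ → ℝ → Module.Dual ℝ (CK d)}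

theorem eq_character (hX : IsBranchedRoughPath α T X) (ht₀ : 0 ≤ t₀) {ω : ℝ × ℝ}
    (hω : ω ∈ timePairs t₀ T) :
    X ω.1 ω.2 = character fun τ => X ω.1 ω.2 (MvPolynomial.X τ) := by
  obtain ⟨h1, h2, h3⟩ := hω
  have hs : ω.1 ∈ Set.Icc 0 T := ⟨by linarith, by linarith⟩
  have ht : ω.2 ∈ Set.Icc 0 T := ⟨by linarith, by linarith⟩
  exact BSeries.eq_character (hX.map_one _ hs _ ht) (hX.map_mul _ hs _ ht)

theorem isBigO_tree (hX : IsBranchedRoughPath α T X) (ht₀ : 0 ≤ t₀) (τ : Tree d) :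
    (fun ω : ℝ × ℝ => X ω.1 ω.2 (MvPolynomial.X τ)) =O[𝓟 (timePairs t₀ T)]
      fun ω => scale α ω ^ τ.size := by
  obtain ⟨C, hC⟩ := hX.holder τ
  refine IsBigO.of_bound C (eventually_principal.2 fun ω hω => ?_)
  have hpos := scale_pos (α := α) hω
  rw [Real.norm_of_nonneg (pow_pos hpos _).le, scale_pow hω, mul_comm (τ.size : ℝ)]
  obtain ⟨h1, h2, h3⟩ := hω
  have := hC ω.1 ⟨by linarith, by linarith⟩ ω.2 ⟨by linarith, by linarith⟩ h2.ne
  rwa [abs_of_pos (sub_pos.2 h2)] at this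

/-- The values on trees of a rough path, rescaled to order one. -/
theorem isBigO_scaled (hX : IsBranchedRoughPath α T X) (ht₀ : 0 ≤ t₀) (τ : Tree d) :
    (fun ω : ℝ × ℝ => (scale α ω)⁻¹ ^ τ.size * X ω.1 ω.2 (MvPolynomial.X τ))
      =O[𝓟 (timePairs t₀ T)] fun _ => (1 : ℝ) := by
  have h := (isBigO_refl (fun ω => (scale α ω)⁻¹ ^ τ.size) (𝓟 (timePairs t₀ T))).mul
    (hX.isBigO_tree ht₀ τ)
  refine h.trans (IsBigO.of_bound 1 (eventually_principal.2 fun ω hω => ?_))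
  rw [← mul_pow, inv_mul_cancel₀ (scale_pos hω).ne', one_pow]
  simp

theorem eq_character_scaled (hX : IsBranchedRoughPath α T X) (ht₀ : 0 ≤ t₀) {ω : ℝ × ℝ}
    (hω : ω ∈ timePairs t₀ T) :
    X ω.1 ω.2 = character (fun τ => (scale α ω)⁻¹ ^ τ.size * X ω.1 ω.2 (MvPolynomial.X τ)) ∘ₗ
      (dilation (scale α ω)).toLinearMap := by
  rw [character_comp_dilation]
  conv_lhs => rw [hX.eq_character ht₀ hω]
  congr 1
  ext τ
  rw [← mul_assoc, ← mul_pow, mul_inv_cancel₀ (scale_pos hω).ne', one_pow, one_mul]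

/-- Both factors are dilations by δ of bounded families of characters. Convolution commutes with
dilation, so δ^|τ| factors out of the value on τ. -/
theorem isBigO_convolve_tree (hX : IsBranchedRoughPath α T X) (ht₀ : 0 ≤ t₀) (μ : Tree d → ℝ)
    (τ : Tree d) :
    (fun ω : ℝ × ℝ => convolve (X ω.1 ω.2) (character fun τ => scale α ω ^ τ.size * μ τ)
      (MvPolynomial.X τ)) =O[𝓟 (timePairs t₀ T)] fun ω => scale α ω ^ τ.size := by
  have h1 := isBigO_convolve (isBigO_character (hX.isBigO_scaled ht₀))
    (fun z => (isBigO_const_const (character μ z) (one_ne_zero (α := ℝ)) (𝓟 (timePairs t₀ T))))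
    (MvPolynomial.X τ)
  have h2 := (isBigO_refl (fun ω => scale α ω ^ τ.size) (𝓟 (timePairs t₀ T))).mul h1
  simp only [mul_one] at h2
  refine h2.congr' (eventually_principal.2 fun ω hω => ?_) EventuallyEq.rfl
  beta_reduce
  rw [← character_comp_dilation μ]
  conv_rhs => rw [hX.eq_character_scaled ht₀ hω]
  rw [convolve_comp_dilation, dilation_X, map_smul, smul_eq_mul]

theorem convolve_toCK (hX : IsBranchedRoughPath α T X) (ht₀ : 0 ≤ t₀) {ω : ℝ × ℝ}
    (hω : ω ∈ timePairs t₀ T) (μ : Tree d → ℝ) (h : Forest d) :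
    convolve (X ω.1 ω.2) (character μ) h.toCK =
      (h.map fun τ => convolve (X ω.1 ω.2) (character μ) (MvPolynomial.X τ)).prod := by
  rw [hX.eq_character ht₀ hω]
  conv_lhs => rw [convolve_character, character_toCK]

end IsBranchedRoughPath

/-! ### Transport defects of f(Y) and near-additivity of B-series increments -/

section defect

variable {d m : ℕ} {α T t₀ : ℝ} {X : ℝ → ℝ → Module.Dual ℝ (CK d)}
  {f : Fin d → EuclideanSpace ℝ (Fin m) → EuclideanSpace ℝ (Fin m)}
  {y : ℝ → EuclideanSpace ℝ (Fin m)}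

/-- The amount by which `fᵢ(Y)` fails to be transported by `X` from `s` to `t`, tested against a
functional `ψ`, where `Y` is the lift of `y` by elementary differentials. -/
noncomputable def defect (X : ℝ → ℝ → Module.Dual ℝ (CK d))
    (f : Fin d → EuclideanSpace ℝ (Fin m) → EuclideanSpace ℝ (Fin m))
    (y : ℝ → EuclideanSpace ℝ (Fin m)) (Q : ℕ) (i : Fin d) (ω : ℝ × ℝ)
    (ψ : Module.Dual ℝ (CK d)) : EuclideanSpace ℝ (Fin m) :=
  (∑ h ∈ forestsUpTo d Q, ψ h.toCK • elemCoeff f (y ω.2) (Tree.graft i h)) -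
    ∑ g ∈ forestsUpTo d Q, convolve (X ω.1 ω.2) ψ g.toCK • elemCoeff f (y ω.1) (Tree.graft i g)

/-- The defect depends on ψ only through forests with at most Q vertices, because right legs of the
coproduct are never larger than the forest (`convolve_eq_sum`). -/
theorem defect_eq_sum (Q : ℕ) (i : Fin d) (ω : ℝ × ℝ) (ψ : Module.Dual ℝ (CK d)) :
    defect X f y Q i ω ψ = ∑ h ∈ forestsUpTo d Q, ψ h.toCK • defect X f y Q i ω h.dual := by
  classical
  simp only [defect, smul_sub, Finset.sum_sub_distrib]
  congr 1
  · refine Finset.sum_congr rfl fun h hh => ?_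
    rw [Finset.sum_eq_single h]
    · rw [Forest.dual_toCK, if_pos rfl, one_smul]
    · intro g _ hg; rw [Forest.dual_toCK, if_neg hg, zero_smul]
    · intro hn; exact absurd hh hn
  · simp only [Finset.smul_sum]
    rw [Finset.sum_comm]
    refine Finset.sum_congr rfl fun g hg => ?_
    rw [convolve_eq_sum _ _ (mem_forestsUpTo.1 hg), Finset.sum_smul]
    simp only [smul_smul]

/-- `y`, lifted by elementary differentials of trees with at most `Q` vertices, is transported by
`X` up to `(t - s) ^ ((Q + 1) α)`, when tested against rescaled characters. -/
def IsTransported (α t₀ T : ℝ) (X : ℝ → ℝ → Module.Dual ℝ (CK d))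
    (f : Fin d → EuclideanSpace ℝ (Fin m) → EuclideanSpace ℝ (Fin m))
    (y : ℝ → EuclideanSpace ℝ (Fin m)) (Q : ℕ) : Prop :=
  ∀ μ : Tree d → ℝ, (fun ω : ℝ × ℝ =>
    (y ω.2 + ∑ τ ∈ treesUpTo d Q, (scale α ω ^ τ.size * μ τ) • elemCoeff f (y ω.2) τ) -
    (y ω.1 + ∑ τ ∈ treesUpTo d Q, convolve (X ω.1 ω.2)
      (character fun τ => scale α ω ^ τ.size * μ τ) (MvPolynomial.X τ) • elemCoeff f (y ω.1) τ))
    =O[𝓟 (timePairs t₀ T)] fun ω => scale α ω ^ (Q + 1)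

theorem isBigO_elemCoeff {P : ℕ} (hf : ∀ i, ContDiff ℝ (P : ℕ∞) (f i)) {ι : Type*} {l : Filter ι}
    {a : ι → EuclideanSpace ℝ (Fin m)} (ha : a =O[l] fun _ => (1 : ℝ)) {τ : Tree d}
    (hτ : τ.size ≤ P + 1) : (fun ω => elemCoeff f (a ω) τ) =O[l] fun _ => (1 : ℝ) :=
  (isBigO_comp_of_continuous (continuous_elemDiff hf _ τ rfl hτ) ha).const_smul_left
    (1 / (τ.symmFactor : ℝ))

variable {P : ℕ}

/-- Transport of the lift of y passes to f_i of it: both Taylor expansions are values of f_i at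
points that agree up to δ^(Q+1). Multiplicativity of the test character and of its convolution with
X identifies these expansions with the two sums in the defect. -/
theorem isBigO_defect_character (hα : 0 < α) (ht₀ : 0 ≤ t₀) (hX : IsBranchedRoughPath α T X)
    (hf : ∀ i, ContDiff ℝ (P : ℕ∞) (f i))
    (hf' : ∀ i, LocallyLipschitz (iteratedFDeriv ℝ P (f i)))
    (hy1 : (fun ω : ℝ × ℝ => y ω.1) =O[𝓟 (timePairs t₀ T)] fun _ => (1 : ℝ))
    (hy2 : (fun ω : ℝ × ℝ => y ω.2) =O[𝓟 (timePairs t₀ T)] fun _ => (1 : ℝ))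
    {Q : ℕ} (hQ : Q ≤ P) (hy : IsTransported α t₀ T X f y Q) (i : Fin d) (μ : Tree d → ℝ) :
    (fun ω => defect X f y Q i ω (character fun τ => scale α ω ^ τ.size * μ τ))
      =O[𝓟 (timePairs t₀ T)] fun ω => scale α ω ^ (Q + 1) := by
  have hfQ : ContDiff ℝ (Q : ℕ∞) (f i) := (hf i).of_le (by exact_mod_cast hQ)
  have hW : ∀ {a : ℝ × ℝ → EuclideanSpace ℝ (Fin m)},
      a =O[𝓟 (timePairs t₀ T)] (fun _ => (1 : ℝ)) → ∀ τ ∈ treesUpTo d Q,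
      (fun ω => elemCoeff f (a ω) τ) =O[𝓟 (timePairs t₀ T)] fun _ => (1 : ℝ) :=
    fun ha τ hτ => isBigO_elemCoeff hf ha (by have := mem_treesUpTo.1 hτ; omega)
  have hμ : ∀ τ, (fun ω => scale α ω ^ τ.size * μ τ) =O[𝓟 (timePairs t₀ T)]
      fun ω => scale α ω ^ τ.size := fun τ => by
    simpa only [mul_comm] using
      (isBigO_refl (fun ω => scale α ω ^ τ.size) (𝓟 (timePairs t₀ T))).const_mul_left (μ τ)
  have key := isBigO_taylorCoeff_sub_taylorCoeff hfQ (locallyLipschitz_iteratedFDeriv (hf i)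
    (hf' i) hQ) (isBigO_scale hα) hy1 hy2 hμ (hX.isBigO_convolve_tree ht₀ μ) (hW hy1) (hW hy2)
    (hy μ)
  refine key.congr' (eventually_principal.2 fun ω hω => ?_) EventuallyEq.rfl
  simp only [defect]
  congr 1
  · refine Finset.sum_congr rfl fun h hh => ?_
    rw [taylorCoeff_elemCoeff hfQ _ (mem_forestsUpTo.1 hh), character_toCK]
  · refine Finset.sum_congr rfl fun h hh => ?_
    rw [taylorCoeff_elemCoeff hfQ _ (mem_forestsUpTo.1 hh), hX.convolve_toCK ht₀ hω]

/-- A fixed finite combination of characters isolates the coefficient of h. The same weights serve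
at every scale, since dilation only multiplies the value on a forest g by δ^|g|. -/
theorem isBigO_defect_dual {Q : ℕ} {i : Fin d}
    (H : ∀ μ : Tree d → ℝ,
      (fun ω => defect X f y Q i ω (character fun τ => scale α ω ^ τ.size * μ τ))
        =O[𝓟 (timePairs t₀ T)] fun ω => scale α ω ^ (Q + 1))
    {h : Forest d} (hh : h ∈ forestsUpTo d Q) :
    (fun ω => scale α ω ^ Forest.size h • defect X f y Q i ω h.dual)
      =O[𝓟 (timePairs t₀ T)] fun ω => scale α ω ^ (Q + 1) := by
  classical
  obtain ⟨c, hc⟩ := exists_finsupp_character (forestsUpTo d Q) h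
  have hsum : (fun ω => ∑ μ ∈ c.support,
      c μ • defect X f y Q i ω (character fun τ => scale α ω ^ τ.size * μ τ))
        =O[𝓟 (timePairs t₀ T)] fun ω => scale α ω ^ (Q + 1) :=
    IsBigO.fun_sum fun μ _ => (H μ).const_smul_left (c μ)
  refine hsum.congr_left fun ω => ?_
  simp only [defect_eq_sum Q i ω (character _), Finset.smul_sum]
  rw [Finset.sum_comm, Finset.sum_eq_single h]
  · have := hc h hh
    rw [if_pos rfl, Finsupp.sum] at this
    simp only [smul_smul, ← Finset.sum_smul]
    congr 1
    rw [← mul_one (scale α ω ^ Forest.size h), ← this, Finset.mul_sum]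
    refine Finset.sum_congr rfl fun μ _ => ?_
    rw [← character_comp_dilation, LinearMap.comp_apply, AlgHom.toLinearMap_apply, dilation_toCK,
      map_smul, smul_eq_mul]
    ring
  · intro g hg hgh
    have := hc g hg
    rw [if_neg hgh, Finsupp.sum] at this
    simp only [smul_smul, ← Finset.sum_smul]
    rw [show (∑ μ ∈ c.support, c μ * character (fun τ => scale α ω ^ τ.size * μ τ) g.toCK) =
      scale α ω ^ Forest.size g * ∑ μ ∈ c.support, c μ * character μ g.toCK from ?_, this, mul_zero,
      zero_smul]
    rw [Finset.mul_sum]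
    refine Finset.sum_congr rfl fun μ _ => ?_
    rw [← character_comp_dilation, LinearMap.comp_apply, AlgHom.toLinearMap_apply, dilation_toCK,
      map_smul, smul_eq_mul]
    ring
  · intro hn; exact absurd hh hn

/-- The coefficientwise bounds lose δ^|h|, which a functional of order δ^|h| on h restores; k extra
powers carry over. The map κ allows the defect to live on one interval while ψ comes from another.
-/
theorem isBigO_defect {Q : ℕ} {i : Fin d}
    (H : ∀ h ∈ forestsUpTo d Q,
      (fun ω => scale α ω ^ Forest.size h • defect X f y Q i ω h.dual)
        =O[𝓟 (timePairs t₀ T)] fun ω => scale α ω ^ (Q + 1))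
    {ι : Type*} {l : Filter ι} {κ : ι → ℝ × ℝ} (hκ : Tendsto κ l (𝓟 (timePairs t₀ T)))
    {ψ : ι → Module.Dual ℝ (CK d)} (k : ℕ)
    (hψ : ∀ h : Forest d, (fun ω => ψ ω h.toCK) =O[l] fun ω => scale α (κ ω) ^ (Forest.size h + k)) :
    (fun ω => defect X f y Q i (κ ω) (ψ ω)) =O[l] fun ω => scale α (κ ω) ^ (Q + 1 + k) := by
  simp only [defect_eq_sum Q i _ (ψ _)]
  refine IsBigO.fun_sum fun h hh => ?_
  have h1 := (hψ h).smul (isBigO_refl (fun ω => defect X f y Q i (κ ω) h.dual) l)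
  have h2 := (isBigO_refl (fun ω => scale α (κ ω) ^ k) l).smul ((H h hh).comp_tendsto hκ)
  refine h1.trans ((h2.congr_left fun ω => ?_).congr_right fun ω => ?_)
  · simp only [Function.comp_apply, smul_smul, ← pow_add, add_comm]
  · simp only [Function.comp_apply, smul_eq_mul, ← pow_add, add_comm]

/-- The B-series of `f` with trees of at most `Q + 1` vertices, without its constant term. -/
noncomputable def bseriesIncrement (X : ℝ → ℝ → Module.Dual ℝ (CK d))
    (f : Fin d → EuclideanSpace ℝ (Fin m) → EuclideanSpace ℝ (Fin m))
    (y : ℝ → EuclideanSpace ℝ (Fin m)) (Q : ℕ) (s t : ℝ) : EuclideanSpace ℝ (Fin m) :=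
  ∑ i, ∑ h ∈ forestsUpTo d Q,
    X s t (MvPolynomial.X (Tree.graft i h)) • elemCoeff f (y s) (Tree.graft i h)

/-- Chen's relation splits X_{s,t} on [h]_i into its value over [s, u] and a convolution with
X_{u,t} ∘ B₊. The latter, compared with the increment restarted at u, is a defect. -/
theorem bseriesIncrement_sub (ht₀ : 0 ≤ t₀) (hX : IsBranchedRoughPath α T X) (Q : ℕ) {s u t : ℝ}
    (hs : t₀ ≤ s) (hsu : s < u) (hut : u < t) (ht : t ≤ T) :
    bseriesIncrement X f y Q s t - bseriesIncrement X f y Q s u - bseriesIncrement X f y Q u t =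
      -∑ i, defect X f y Q i (s, u) (X u t ∘ₗ Bplus i) := by
  have hs' : s ∈ Set.Icc 0 T := ⟨by linarith, by linarith⟩
  have hu' : u ∈ Set.Icc 0 T := ⟨by linarith, by linarith⟩
  have ht' : t ∈ Set.Icc 0 T := ⟨by linarith, by linarith⟩
  have hchen : ∀ (i : Fin d) (h : Forest d), X s t (MvPolynomial.X (Tree.graft i h)) =
      X s u (MvPolynomial.X (Tree.graft i h)) +
        convolve (X s u) (X u t ∘ₗ Bplus i) h.toCK := by
    intro i h
    rw [hX.chen s hs' u hu' t ht', convolve_X_graft, hX.map_one u hu' t ht', mul_one]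
  simp only [bseriesIncrement, ← Finset.sum_sub_distrib, ← Finset.sum_neg_distrib]
  refine Finset.sum_congr rfl fun i _ => ?_
  simp only [defect, hchen, add_smul, Finset.sum_sub_distrib, Finset.sum_add_distrib,
    LinearMap.comp_apply, Bplus_toCK]
  abel

end defect

/-! ### Local expansion of a solution and induction on the order -/

section solution

variable {d m : ℕ} {α T t₀ : ℝ} {X : ℝ → ℝ → Module.Dual ℝ (CK d)}
  {f : Fin d → EuclideanSpace ℝ (Fin m) → EuclideanSpace ℝ (Fin m)}
  {y : ℝ → EuclideanSpace ℝ (Fin m)}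

/-- The local expansion of `y` along the B-series with trees of at most `Q + 1` vertices. -/
theorem isBigO_sub_bseriesIncrement (hα : 0 < α) (ht₀ : 0 ≤ t₀) (hX : IsBranchedRoughPath α T X)
    {Q : ℕ} (hθ : 1 < ((Q + 1 + 1 : ℕ) : ℝ) * α)
    (H : ∀ i, ∀ h ∈ forestsUpTo d Q,
      (fun ω => scale α ω ^ Forest.size h • defect X f y Q i ω h.dual)
        =O[𝓟 (timePairs t₀ T)] fun ω => scale α ω ^ (Q + 1))
    (hlim : ∀ s t, t₀ ≤ s → s < t → t ≤ T →
      Tendsto (fun n => dyadicSum (bseriesIncrement X f y Q) n s t) atTop (𝓝 (y t - y s))) :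
    (fun ω : ℝ × ℝ => y ω.2 - y ω.1 - bseriesIncrement X f y Q ω.1 ω.2)
      =O[𝓟 (timePairs t₀ T)] fun ω => scale α ω ^ (Q + 1 + 1) := by
  -- Grafting adds one vertex, hence one extra power of the scale. The right half has the same
  -- length as the left half, on which the defect is taken.
  have hψ : ∀ (i : Fin d) (h : Forest d),
      (fun ω : ℝ × ℝ => (X ((ω.1 + ω.2) / 2) ω.2 ∘ₗ Bplus i) h.toCK)
        =O[𝓟 (timePairs t₀ T)]
        fun ω => scale α (ω.1, (ω.1 + ω.2) / 2) ^ (Forest.size h + 1) := by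
    intro i h
    have h1 := (hX.isBigO_tree ht₀ (Tree.graft i h)).comp_tendsto tendsto_right_half
    refine (h1.congr_left fun ω => ?_).congr_right fun ω => ?_
    · simp only [Function.comp_apply, LinearMap.comp_apply, Bplus_toCK]
    · simp only [Function.comp_apply, scale_right_half, Tree.size_graft, add_comm]
  have h1 : (fun ω : ℝ × ℝ => bseriesIncrement X f y Q ω.1 ω.2 -
      bseriesIncrement X f y Q ω.1 ((ω.1 + ω.2) / 2) -
      bseriesIncrement X f y Q ((ω.1 + ω.2) / 2) ω.2)
      =O[𝓟 (timePairs t₀ T)] fun ω => scale α ω ^ (Q + 1 + 1) := by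
    have h2 : (fun ω : ℝ × ℝ => -∑ i, defect X f y Q i (ω.1, (ω.1 + ω.2) / 2)
        (X ((ω.1 + ω.2) / 2) ω.2 ∘ₗ Bplus i))
        =O[𝓟 (timePairs t₀ T)] fun ω => scale α ω ^ (Q + 1 + 1) :=
      (IsBigO.fun_sum fun i _ => (isBigO_defect (H i) tendsto_left_half 1 (hψ i)).trans
        (isBigO_scale_left_half hα _)).neg_left
    refine h2.congr' (eventually_principal.2 fun ω hω => ?_) EventuallyEq.rfl
    exact (bseriesIncrement_sub ht₀ hX Q hω.1 (by linarith [hω.2.1]) (by linarith [hω.2.1])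
      hω.2.2).symm
  obtain ⟨C, hC⟩ := h1.bound
  rw [eventually_principal] at hC
  have hC' : ∀ s t, t₀ ≤ s → s < t → t ≤ T →
      ‖bseriesIncrement X f y Q s t - bseriesIncrement X f y Q s ((s + t) / 2) -
        bseriesIncrement X f y Q ((s + t) / 2) t‖ ≤ C * (t - s) ^ (((Q + 1 + 1 : ℕ) : ℝ) * α) := by
    intro s t hs hst ht
    have hω : (s, t) ∈ timePairs t₀ T := ⟨hs, hst, ht⟩
    have := hC (s, t) hω
    rwa [Real.norm_of_nonneg (pow_pos (scale_pos hω) _).le, scale_pow hω] at this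
  refine IsBigO.of_bound (C / (1 - 2 ^ (1 - ((Q + 1 + 1 : ℕ) : ℝ) * α)))
    (eventually_principal.2 fun ω hω => ?_)
  rw [Real.norm_of_nonneg (pow_pos (scale_pos hω) _).le, scale_pow hω]
  exact norm_sub_le_of_tendsto_dyadicSum hθ hC' hω.1 hω.2.1 hω.2.2 (hlim _ _ hω.1 hω.2.1 hω.2.2)

/-- On [h]_i the coproduct recursion separates the term of X alone from a convolution with χ ∘ B₊.
The first terms sum to the B-series increment, and the rest combine with the lift at t into defects
tested against χ ∘ B₊, which gain one power of δ. -/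
theorem IsTransported.succ_of_expansion {Q : ℕ}
    (H : ∀ i, ∀ h ∈ forestsUpTo d Q,
      (fun ω => scale α ω ^ Forest.size h • defect X f y Q i ω h.dual)
        =O[𝓟 (timePairs t₀ T)] fun ω => scale α ω ^ (Q + 1))
    (hexp : (fun ω : ℝ × ℝ => y ω.2 - y ω.1 - bseriesIncrement X f y Q ω.1 ω.2)
      =O[𝓟 (timePairs t₀ T)] fun ω => scale α ω ^ (Q + 1 + 1)) :
    IsTransported α t₀ T X f y (Q + 1) := by
  intro μ
  have hψ : ∀ (i : Fin d) (h : Forest d), (fun ω : ℝ × ℝ =>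
      ((character fun τ => scale α ω ^ τ.size * μ τ) ∘ₗ Bplus i) h.toCK)
        =O[𝓟 (timePairs t₀ T)] fun ω => scale α ω ^ (Forest.size h + 1) := by
    intro i h
    simp only [LinearMap.comp_apply, Bplus_toCK, character_X, Tree.size_graft, add_comm 1]
    simpa only [mul_comm] using (isBigO_refl (fun ω => scale α ω ^ (Forest.size h + 1))
      (𝓟 (timePairs t₀ T))).const_mul_left (μ (Tree.graft i h))
  have h1 : (fun ω : ℝ × ℝ => ∑ i, defect X f y Q i ω
      ((character fun τ => scale α ω ^ τ.size * μ τ) ∘ₗ Bplus i))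
      =O[𝓟 (timePairs t₀ T)] fun ω => scale α ω ^ (Q + 1 + 1) :=
    IsBigO.fun_sum fun i _ => isBigO_defect (κ := id) (H i) tendsto_id 1 (hψ i)
  refine (hexp.add h1).congr_left fun ω => ?_
  simp only [sum_treesUpTo_succ, convolve_X_graft, character_one, mul_one, add_smul,
    Finset.sum_add_distrib, defect, bseriesIncrement, Finset.sum_sub_distrib, LinearMap.comp_apply,
    Bplus_toCK, character_X]
  abel

/-- The lift of a solution is given by elementary differentials. -/
theorem IsControlledIntegral.coeff_eq_elemCoeff {Y : ℝ → Forest d → EuclideanSpace ℝ (Fin m)}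
    (hf : ∀ i, ContDiff ℝ ((levels α - 1 : ℕ) : ℕ∞) (f i))
    (hY : IsControlledIntegral α X t₀ T (fun i t => compose α (f i) (Y t)) Y) {t : ℝ}
    (ht : t ∈ Set.Icc t₀ T) (n : ℕ) : ∀ τ : Tree d, τ.size = n → n ≤ levels α - 1 →
    Y t {τ} = elemCoeff f (Y t 0) τ := by
  induction n using Nat.strong_induction_on with
  | _ n ih =>
    intro τ hτ hn
    obtain ⟨i, h, rfl⟩ : ∃ i h, τ = Tree.graft i h := ⟨_, _, τ.graft_root_branches.symm⟩
    have hsize := Tree.size_graft i h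
    rw [hY.coeff_tree t ht i h (by omega), compose_eq_taylorCoeff (hf i) (hY.coeff_forest t ht),
      ← taylorCoeff_elemCoeff (hf i) _ (by omega)]
    refine taylorCoeff_congr fun τ hτh => ih _ ?_ τ rfl ?_
    all_goals
      have := Tree.size_le_forest hτh
      omega

theorem IsControlledIntegral.compose_eq_elemCoeff {Y : ℝ → Forest d → EuclideanSpace ℝ (Fin m)}
    (hf : ∀ i, ContDiff ℝ ((levels α - 1 : ℕ) : ℕ∞) (f i))
    (hY : IsControlledIntegral α X t₀ T (fun i t => compose α (f i) (Y t)) Y) {t : ℝ}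
    (ht : t ∈ Set.Icc t₀ T) (i : Fin d) {h : Forest d} (hh : Forest.size h ≤ levels α - 1) :
    compose α (f i) (Y t) h = elemCoeff f (Y t 0) (Tree.graft i h) := by
  rw [compose_eq_taylorCoeff (hf i) (hY.coeff_forest t ht), ← taylorCoeff_elemCoeff (hf i) _ hh]
  refine taylorCoeff_congr fun τ hτh => hY.coeff_eq_elemCoeff hf ht _ τ rfl ?_
  exact (Tree.size_le_forest hτh).trans hh

theorem one_le_levels (hα : 0 < α) (hα1 : α ≤ 1) : 1 ≤ levels α :=
  Nat.le_floor (by rw [Nat.cast_one]; exact (one_le_div hα).2 hα1)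

theorem one_lt_of_levels_le (hα : 0 < α) {Q : ℕ} (hQ : levels α ≤ Q + 1) :
    1 < ((Q + 1 + 1 : ℕ) : ℝ) * α := by
  have h1 : 1 / α < (levels α : ℝ) + 1 := Nat.lt_floor_add_one _
  have h2 : (levels α : ℝ) ≤ (Q : ℝ) + 1 := by exact_mod_cast hQ
  rw [← div_lt_iff₀ hα]
  push_cast
  linarith

/-- A path controlled by a rough path is bounded. -/
theorem IsControlled.exists_norm_le (hX : IsBranchedRoughPath α T X) (hα : 0 < α) (ht₀ : 0 ≤ t₀)
    {Y : ℝ → Forest d → EuclideanSpace ℝ (Fin m)} (hY : IsControlled α X t₀ T Y) :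
    ∃ R, ∀ t ∈ Set.Icc t₀ T, ‖Y t 0‖ ≤ R := by
  obtain ⟨C, hC⟩ := hY 0 (by simp [mem_forestsUpTo])
  -- Starting always from t₀, the controlled expansion involves only the fixed coefficients of Y at
  -- t₀. The endpoint t = t₀ is not an ordered pair and is covered by the maximum below.
  have hκ : Tendsto (fun t => (t₀, t)) (𝓟 (Set.Ioc t₀ T)) (𝓟 (timePairs t₀ T)) :=
    tendsto_principal_principal.2 fun t ht => ⟨le_rfl, ht.1, ht.2⟩
  have hXb : ∀ z, (fun ω : ℝ × ℝ => X ω.1 ω.2 z) =O[𝓟 (timePairs t₀ T)] fun _ => (1 : ℝ) := by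
    intro z
    have h1 := isBigO_character (ξ := fun (ω : ℝ × ℝ) τ => X ω.1 ω.2 (MvPolynomial.X τ))
      (fun τ => (hX.isBigO_tree ht₀ τ).trans (isBigO_scale_pow hα _)) z
    refine h1.congr' (eventually_principal.2 fun ω hω => ?_) EventuallyEq.rfl
    beta_reduce
    conv_rhs => rw [hX.eq_character ht₀ hω]
  have h1 : (fun ω : ℝ × ℝ => ∑ g ∈ forestsUpTo d (levels α - 1),
      convolve (X ω.1 ω.2) (Forest.dual 0) g.toCK • Y t₀ g)
      =O[𝓟 (timePairs t₀ T)] fun _ => (1 : ℝ) := by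
    refine IsBigO.fun_sum fun g _ => ?_
    have := isBigO_convolve hXb (fun z => (isBigO_const_const (Forest.dual (0 : Forest d) z)
      (one_ne_zero (α := ℝ)) (𝓟 (timePairs t₀ T)))) g.toCK
    simpa using this.smul (isBigO_const_const (Y t₀ g) (one_ne_zero (α := ℝ))
      (𝓟 (timePairs t₀ T)))
  have h2 : (fun ω : ℝ × ℝ => Y ω.2 0 - ∑ g ∈ forestsUpTo d (levels α - 1),
      convolve (X ω.1 ω.2) (Forest.dual 0) g.toCK • Y ω.1 g)
      =O[𝓟 (timePairs t₀ T)] fun ω => scale α ω ^ levels α := by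
    refine IsBigO.of_bound C (eventually_principal.2 fun ω hω => ?_)
    have := hC ω.1 ⟨hω.1, hω.2.1.le.trans hω.2.2⟩ ω.2 ⟨hω.1.trans hω.2.1.le, hω.2.2⟩
    rw [Real.norm_of_nonneg (pow_pos (scale_pos hω) _).le, scale_pow hω]
    simpa [abs_of_pos (sub_pos.2 hω.2.1)] using this
  have h3 := (h2.trans (isBigO_scale_pow hα _)).comp_tendsto hκ
  obtain ⟨R, hR⟩ := (h3.add (h1.comp_tendsto hκ)).bound
  rw [eventually_principal] at hR
  refine ⟨max R ‖Y t₀ 0‖, fun t ht => ?_⟩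
  rcases ht.1.eq_or_lt with rfl | hlt
  · exact le_max_right _ _
  · refine le_trans ?_ (le_max_left _ _)
    simpa using hR t ⟨hlt, ht.2⟩

/-- The remainder at h is O(δ^(N-|h|)) and a scaled character is O(δ^|h|) on h, so every forest
contributes O(δ^N). -/
theorem IsControlled.isTransported (hX : IsBranchedRoughPath α T X) (hα : 0 < α) (hα1 : α ≤ 1)
    (ht₀ : 0 ≤ t₀) (hf : ∀ i, ContDiff ℝ ((levels α - 1 : ℕ) : ℕ∞) (f i))
    {Y : ℝ → Forest d → EuclideanSpace ℝ (Fin m)} (hY : IsControlled α X t₀ T Y)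
    (hY' : IsControlledIntegral α X t₀ T (fun i t => compose α (f i) (Y t)) Y)
    (hy : ∀ t ∈ Set.Icc t₀ T, Y t 0 = y t) :
    IsTransported α t₀ T X f y (levels α - 1) := by
  intro μ
  have hlev := one_le_levels hα hα1
  have h1 : (fun ω : ℝ × ℝ => ∑ h ∈ forestsUpTo d (levels α - 1),
      character (fun τ => scale α ω ^ τ.size * μ τ) h.toCK •
        (Y ω.2 h - ∑ g ∈ forestsUpTo d (levels α - 1),
          convolve (X ω.1 ω.2) h.dual g.toCK • Y ω.1 g))
      =O[𝓟 (timePairs t₀ T)] fun ω => scale α ω ^ (levels α - 1 + 1) := by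
    refine IsBigO.fun_sum fun h hh => ?_
    have hs := mem_forestsUpTo.1 hh
    obtain ⟨C, hC⟩ := hY h hh
    have h2 : (fun ω : ℝ × ℝ => Y ω.2 h - ∑ g ∈ forestsUpTo d (levels α - 1),
          convolve (X ω.1 ω.2) h.dual g.toCK • Y ω.1 g)
        =O[𝓟 (timePairs t₀ T)] fun ω => scale α ω ^ (levels α - Forest.size h) := by
      refine IsBigO.of_bound C (eventually_principal.2 fun ω hω => ?_)
      have := hC ω.1 ⟨hω.1, hω.2.1.le.trans hω.2.2⟩ ω.2 ⟨hω.1.trans hω.2.1.le, hω.2.2⟩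
      rw [Real.norm_of_nonneg (pow_pos (scale_pos hω) _).le, scale_pow hω,
        Nat.cast_sub (by omega)]
      simpa [abs_of_pos (sub_pos.2 hω.2.1)] using this
    have h3 : (fun ω : ℝ × ℝ => character (fun τ => scale α ω ^ τ.size * μ τ) h.toCK)
        =O[𝓟 (timePairs t₀ T)] fun ω => scale α ω ^ Forest.size h := by
      simp only [character_toCK]
      exact isBigO_forest_prod (fun τ => by
        simpa only [mul_comm] using (isBigO_refl (fun ω => scale α ω ^ τ.size)
          (𝓟 (timePairs t₀ T))).const_mul_left (μ τ)) h
    refine (h3.smul h2).congr_right fun ω => ?_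
    rw [smul_eq_mul, ← pow_add]
    congr 1
    omega
  refine h1.congr' (eventually_principal.2 fun ω hω => ?_) EventuallyEq.rfl
  have hs : ω.1 ∈ Set.Icc t₀ T := ⟨hω.1, hω.2.1.le.trans hω.2.2⟩
  have ht : ω.2 ∈ Set.Icc t₀ T := ⟨hω.1.trans hω.2.1.le, hω.2.2⟩
  have hX1 : X ω.1 ω.2 1 = 1 :=
    hX.map_one _ ⟨ht₀.trans hs.1, hs.2⟩ _ ⟨ht₀.trans ht.1, ht.2⟩
  -- Coefficients at products of trees vanish, so the pairing with Y reduces to the empty forest and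
  -- single trees.
  have hsplit : ∀ (ψ : Module.Dual ℝ (CK d)) (t : ℝ), t ∈ Set.Icc t₀ T → ψ 1 = 1 →
      ∑ h ∈ forestsUpTo d (levels α - 1), ψ h.toCK • Y t h =
        y t + ∑ τ ∈ treesUpTo d (levels α - 1), ψ (MvPolynomial.X τ) • elemCoeff f (y t) τ := by
    intro ψ t ht hψ
    rw [sum_forestsUpTo_eq _ _ fun h hh hcard => by
      rw [hY'.coeff_forest t ht h hh hcard, smul_zero]]
    rw [Forest.toCK_zero, hψ, one_smul, hy t ht]
    congr 1
    refine Finset.sum_congr rfl fun τ hτ => ?_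
    rw [hY'.coeff_eq_elemCoeff hf ht _ τ rfl (mem_treesUpTo.1 hτ), Forest.toCK_singleton, hy t ht]
  have h4 := hsplit (character fun τ => scale α ω ^ τ.size * μ τ) ω.2 ht (character_one _)
  have h5 := hsplit (convolve (X ω.1 ω.2) (character fun τ => scale α ω ^ τ.size * μ τ)) ω.1 hs
    (by rw [convolve_one, hX1, character_one, mul_one])
  simp only [character_X] at h4
  beta_reduce
  rw [← h4, ← h5]
  simp only [smul_sub, Finset.sum_sub_distrib, Finset.smul_sum]
  congr 1
  rw [Finset.sum_comm]
  refine Finset.sum_congr rfl fun g hg => ?_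
  rw [convolve_eq_sum _ _ (mem_forestsUpTo.1 hg), Finset.sum_smul]
  simp only [smul_smul]

/-- The dyadic sums of the B-series increments of any sufficiently high order converge to the
increments of a solution. -/
theorem IsControlledIntegral.tendsto_dyadicSum_bseriesIncrement {P : ℕ}
    (hX : IsBranchedRoughPath α T X) (hα : 0 < α) (hα1 : α ≤ 1) (ht₀ : 0 ≤ t₀)
    (hf : ∀ i, ContDiff ℝ (P : ℕ∞) (f i))
    (hy1 : (fun ω : ℝ × ℝ => y ω.1) =O[𝓟 (timePairs t₀ T)] fun _ => (1 : ℝ))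
    {Y : ℝ → Forest d → EuclideanSpace ℝ (Fin m)}
    (hY : IsControlledIntegral α X t₀ T (fun i t => compose α (f i) (Y t)) Y)
    (hy : ∀ t ∈ Set.Icc t₀ T, Y t 0 = y t) {Q : ℕ} (hQ : levels α - 1 ≤ Q) (hQP : Q ≤ P)
    {s t : ℝ} (hs : t₀ ≤ s) (hst : s < t) (ht : t ≤ T) :
    Tendsto (fun n => dyadicSum (bseriesIncrement X f y Q) n s t) atTop (𝓝 (y t - y s)) := by
  classical
  have hlev := one_le_levels hα hα1
  have hfL : ∀ i, ContDiff ℝ ((levels α - 1 : ℕ) : ℕ∞) (f i) :=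
    fun i => (hf i).of_le (by exact_mod_cast hQ.trans hQP)
  have hs' : s ∈ Set.Icc t₀ T := ⟨hs, hst.le.trans ht⟩
  have ht' : t ∈ Set.Icc t₀ T := ⟨hs.trans hst.le, ht⟩
  set I : ℝ → ℝ → EuclideanSpace ℝ (Fin m) := fun s t =>
    ∑ i, localIntegral α X (fun t => compose α (f i) (Y t)) i s t with hI
  have h1 : Tendsto (fun n => dyadicSum I n s t) atTop (𝓝 (y t - y s)) := by
    obtain ⟨L, hL, hLs⟩ := hY.coeff_one s hs' t ht' hst.le
    rw [← hy t ht', ← hy s hs', hLs]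
    simp only [hI, dyadicSum_sum]
    exact tendsto_finsetSum _ fun i _ => (hL i).tendsto_dyadicSum hst
  -- The exponent is N + 1, as N ≥ 1. The two increments differ only by trees with more than N
  -- vertices, and (N + 1)α > 1 makes the dyadic sums of the difference vanish.
  have hdiff : (fun ω : ℝ × ℝ => bseriesIncrement X f y Q ω.1 ω.2 - I ω.1 ω.2)
      =O[𝓟 (timePairs t₀ T)] fun ω => scale α ω ^ (levels α - 1 + 1 + 1) := by
    have h2 : (fun ω : ℝ × ℝ => ∑ i, ∑ h ∈ forestsUpTo d Q \ forestsUpTo d (levels α - 1),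
        X ω.1 ω.2 (MvPolynomial.X (Tree.graft i h)) • elemCoeff f (y ω.1) (Tree.graft i h))
        =O[𝓟 (timePairs t₀ T)] fun ω => scale α ω ^ (levels α - 1 + 1 + 1) := by
      refine IsBigO.fun_sum fun i _ => IsBigO.fun_sum fun h hh => ?_
      rw [Finset.mem_sdiff, mem_forestsUpTo, mem_forestsUpTo] at hh
      have hsize := Tree.size_graft i h
      have h3 := (hX.isBigO_tree ht₀ (Tree.graft i h)).trans
        (isBigO_pow_of_le (isBigO_scale hα)
          (by omega : levels α - 1 + 1 + 1 ≤ (Tree.graft i h).size))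
      simpa using h3.smul (isBigO_elemCoeff hf hy1 (τ := Tree.graft i h) (by omega))
    refine h2.congr' (eventually_principal.2 fun ω hω => ?_) EventuallyEq.rfl
    have hω1 : ω.1 ∈ Set.Icc t₀ T := ⟨hω.1, hω.2.1.le.trans hω.2.2⟩
    have hsub : forestsUpTo d (levels α - 1) ⊆ forestsUpTo d Q := fun h hh => by
      rw [mem_forestsUpTo] at hh ⊢; omega
    simp only [hI, bseriesIncrement, localIntegral, ← Finset.sum_sub_distrib]
    refine Finset.sum_congr rfl fun i _ => ?_
    rw [← Finset.sum_sdiff hsub, eq_sub_iff_add_eq]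
    congr 1
    refine Finset.sum_congr rfl fun h hh => ?_
    rw [hY.compose_eq_elemCoeff hfL hω1 i (mem_forestsUpTo.1 hh), hy _ hω1]
  obtain ⟨C, hC⟩ := hdiff.bound
  rw [eventually_principal] at hC
  have hC' : ∀ s t, t₀ ≤ s → s < t → t ≤ T → ‖bseriesIncrement X f y Q s t - I s t‖ ≤
      C * (t - s) ^ (((levels α - 1 + 1 + 1 : ℕ) : ℝ) * α) := by
    intro s t hs hst ht
    have hω : (s, t) ∈ timePairs t₀ T := ⟨hs, hst, ht⟩
    have := hC (s, t) hω
    rwa [Real.norm_of_nonneg (pow_pos (scale_pos hω) _).le, scale_pow hω] at this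
  have h4 := tendsto_dyadicSum_zero (one_lt_of_levels_le hα (by omega)) hC' hs hst ht
  have h5 := h4.add h1
  rw [zero_add] at h5
  refine h5.congr fun n => ?_
  rw [← dyadicSum_add]
  simp only [sub_add_cancel]

theorem IsRDESolution.isTransported {p : ℕ} {y₀ : EuclideanSpace ℝ (Fin m)} (hα : 0 < α)
    (hα1 : α ≤ 1) (ht₀ : 0 ≤ t₀) (hX : IsBranchedRoughPath α T X) (hp : levels α ≤ p)
    (hf : ∀ i, ContDiff ℝ ((p - 1 : ℕ) : ℕ∞) (f i))
    (hf' : ∀ i, LocallyLipschitz (iteratedFDeriv ℝ (p - 1) (f i)))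
    (hy : IsRDESolution α X f t₀ T y₀ y) : IsTransported α t₀ T X f y p := by
  obtain ⟨-, Y, hYy, hY, hY'⟩ := hy
  have hlev := one_le_levels hα hα1
  have hfL : ∀ i, ContDiff ℝ ((levels α - 1 : ℕ) : ℕ∞) (f i) :=
    fun i => (hf i).of_le (by exact_mod_cast Nat.sub_le_sub_right hp 1)
  obtain ⟨R, hR⟩ := hY.exists_norm_le hX hα ht₀
  have hb : ∀ t ∈ Set.Icc t₀ T, ‖y t‖ ≤ R * ‖(1 : ℝ)‖ := fun t ht => by
    rw [norm_one, mul_one, ← hYy t ht]; exact hR t ht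
  have hy1 : (fun ω : ℝ × ℝ => y ω.1) =O[𝓟 (timePairs t₀ T)] fun _ => (1 : ℝ) :=
    IsBigO.of_bound R (eventually_principal.2 fun ω hω =>
      hb _ ⟨hω.1, hω.2.1.le.trans hω.2.2⟩)
  have hy2 : (fun ω : ℝ × ℝ => y ω.2) =O[𝓟 (timePairs t₀ T)] fun _ => (1 : ℝ) :=
    IsBigO.of_bound R (eventually_principal.2 fun ω hω =>
      hb _ ⟨hω.1.trans hω.2.1.le, hω.2.2⟩)
  suffices H : ∀ Q, levels α - 1 ≤ Q → Q ≤ p → IsTransported α t₀ T X f y Q from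
    H p (by omega) le_rfl
  intro Q hQ
  induction Q, hQ using Nat.le_induction with
  | base => exact fun _ => hY.isTransported hX hα hα1 ht₀ hfL hY' hYy
  | succ Q hQ ih =>
    intro hQp
    -- Going from Q to Q + 1 ≤ p uses the Q-th derivative of f and its local Lipschitz bound, so p -
    -- 1 is the highest order needed.
    have hQP : Q ≤ p - 1 := by omega
    have hdef : ∀ i, ∀ h ∈ forestsUpTo d Q,
        (fun ω => scale α ω ^ Forest.size h • defect X f y Q i ω h.dual)
          =O[𝓟 (timePairs t₀ T)] fun ω => scale α ω ^ (Q + 1) := fun i h hh =>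
      isBigO_defect_dual (isBigO_defect_character hα ht₀ hX hf hf' hy1 hy2 hQP
        (ih (by omega)) i) hh
    exact IsTransported.succ_of_expansion hdef
      (isBigO_sub_bseriesIncrement hα ht₀ hX (one_lt_of_levels_le hα (by omega)) hdef
        fun s t hs hst ht => hY'.tendsto_dyadicSum_bseriesIncrement hX hα hα1 ht₀ hf hy1 hYy hQ hQP
          hs hst ht)

end solution

end BSeries

theorem mainTheorem4 {d m : ℕ} (α T : ℝ) (hα : 0 < α) (hα1 : α ≤ 1)
    (X : ℝ → ℝ → Module.Dual ℝ (BSeries.CK d)) (hX : BSeries.IsBranchedRoughPath α T X)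
    (p : ℕ) (hp : ⌊1 / α⌋₊ ≤ p)
    (f : Fin d → EuclideanSpace ℝ (Fin m) → EuclideanSpace ℝ (Fin m))
    (hf : ∀ i, ContDiff ℝ ((p - 1 : ℕ) : ℕ∞) (f i))
    (hf' : ∀ i, LocallyLipschitz (iteratedFDeriv ℝ (p - 1) (f i)))
    (t₀ : ℝ) (ht₀ : 0 ≤ t₀)
    (y₀ : EuclideanSpace ℝ (Fin m)) (y : ℝ → EuclideanSpace ℝ (Fin m))
    (hy : BSeries.IsRDESolution α X f t₀ T y₀ y) :
    ∃ C : ℝ, ∀ h : ℝ, 0 < h → t₀ + h ≤ T →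
      ‖y (t₀ + h) - (y₀ + ∑ τ ∈ BSeries.treesUpTo d p,
          (1 / (τ.symmFactor : ℝ)) •
            X t₀ (t₀ + h) (MvPolynomial.X τ) • BSeries.elemDiff f τ y₀)‖ ≤
        C * h ^ (((p : ℝ) + 1) * α) := by
  -- With μ = 0 the sum at the later time disappears and X ⋆ χ reduces to X on trees, which leaves
  -- exactly the B-series remainder.
  have key := hy.isTransported hα hα1 ht₀ hX hp hf hf' fun _ => 0
  obtain ⟨C, hC⟩ := key.bound
  rw [Filter.eventually_principal] at hC
  refine ⟨C, fun h hh hT => ?_⟩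
  have hω : (t₀, t₀ + h) ∈ BSeries.timePairs t₀ T := ⟨le_rfl, by simpa using hh, hT⟩
  have := hC (t₀, t₀ + h) hω
  rw [Real.norm_of_nonneg (pow_pos (BSeries.scale_pos hω) _).le, BSeries.scale_pow hω] at this
  simp only [mul_zero, zero_smul, Finset.sum_const_zero, add_zero,
    BSeries.convolve_character_zero_X, BSeries.elemCoeff, hy.1, add_sub_cancel_left, Nat.cast_add,
    Nat.cast_one] at this
  simpa only [smul_comm (1 / _ : ℝ)] using this
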